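/- Let $\mathfrak X$ and $U$ be separable Hilbert spaces (both real or both complex), let $T>0$, let $A:D(A)\subset\mathfrak X\to\mathfrak X$ be the generator of a $C_0$-semigroup $(\mathfrak U(t))_{t\ge 0}$ on $\mathfrak X$ such that $\mathfrak U(t)$ is a compact operator for every $t>0$, and let $B:U\to\mathfrak X$ be a bounded linear operator. Let $f,g:[0,T]\times\mathfrak X\to\mathfrak X$ be continuous functions such that: (F) for every $t\in[0,T]$ the map $f(t,\cdot)$ is Fréchet differentiable on $\mathfrak X$, its derivative $f'_z:[0,T]\times\mathfrak X\to L(\mathfrak X)$ is continuous (for the operator norm), and there is $L>0$ with $\|f'_z(t,z)\|_{L(\mathfrak X)}\le L$ for all $(t,z)\in[0,T]\times\mathfrak X$; (G) there is a continuous $m:[0,T]\to[0,\infty)$ with $\|g(t,z)\|\le m(t)$ for all $(t,z)\in[0,T]\times\mathfrak X$. For $N:[0,T]\times\mathfrak X\to\mathfrak X$, $y_0\in\mathfrak X$ and $u\in L^2([0,T],U)$, a mild solution of $$y'(t)=Ay(t)+Bu(t)+N(t,y(t)),\quad t\in[0,T],\qquad y(0)=y_0,$$ is a function $y\in C([0,T],\mathfrak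 X)$ with $$y(t)=\mathfrak U(t)y_0+\int_0^t\mathfrak U(t-s)\bigl[Bu(s)+N(s,y(s))\bigr]\,ds\qquad\text{for all }t\in[0,T].$$ The system is called approximately controllable on $[0,T]$ if for all $y_0,y_f\in\mathfrak X$ and every $\varepsilon>0$ there are a control $u\in L^2([0,T],U)$ and a mild solution $y$ with $y(0)=y_0$ and $\|y(T)-y_f\|<\varepsilon$. Assume further: (AC) for every $G\in L^2(0,T;L(\mathfrak X))$ (Bochner space for the operator norm) the linear system $y'=Ay+Bu+G(t)y$ is approximately controllable on $[0,T]$. Then the semilinear system $y'=Ay+Bu+f(t,y)+g(t,y)$ is finite-approximately controllable on $[0,T]$: for every finite-dimensional subspace $M\subset\mathfrak X$, with orthogonal projection $\pi_M$ of $\mathfrak X$ onto $M$, for all $y_0,y_f\in\mathfrak X$ and every $\varepsilon>0$, there are a control $u\in L^2([0,T],U)$ and a mild solution $y$ of $$y'(t)=Ay(t)+Bu(t)+f(t,y(t))+g(t,y(t)),\qquad y(0)=y_0,$$ such that $\|y(T)-y_f\|<\varepsilon$ and $\pi_My(T)=\pi_My_f$. -/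

import Mathlib

open MeasureTheory Set Filter Topology

/-- A strongly continuous one-parameter semigroup `(S t)_{t ≥ 0}` of bounded linear operators.
The values at negative times carry no information and are never used. -/
structure C0Semigroup (𝕜 X : Type*) [RCLike 𝕜] [NormedAddCommGroup X] [InnerProductSpace 𝕜 X] where
  toFun : ℝ → X →L[𝕜] X
  map_zero : toFun 0 = ContinuousLinearMap.id 𝕜 X
  map_add : ∀ s t : ℝ, 0 ≤ s → 0 ≤ t → toFun (s + t) = (toFun s).comp (toFun t)
  strong_continuity : ∀ x : X, ContinuousOn (fun t => toFun t x) (Ici 0)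

instance (𝕜 X : Type*) [RCLike 𝕜] [NormedAddCommGroup X] [InnerProductSpace 𝕜 X] :
    CoeFun (C0Semigroup 𝕜 X) (fun _ => ℝ → X →L[𝕜] X) := ⟨C0Semigroup.toFun⟩

section

variable {𝕜 X U : Type*} [RCLike 𝕜] [NormedAddCommGroup X] [InnerProductSpace 𝕜 X]
  [NormedSpace ℝ X] [NormedAddCommGroup U] [InnerProductSpace 𝕜 U]

/-- `A` is the infinitesimal generator of `S`: one has `x ∈ D(A)` and `A x = w` exactly when
`(S h x - x) / h → w` as `h → 0+`. -/
def C0Semigroup.IsGenerator (S : C0Semigroup 𝕜 X) (A : X →ₗ.[𝕜] X) : Prop :=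
  ∀ x w : X, (x, w) ∈ A.graph ↔
    Tendsto (fun h : ℝ => h⁻¹ • (S h x - x)) (𝓝[>] 0) (𝓝 w)

/-- The semigroup is compact: `S t` is a compact operator for each `t > 0`. -/
def C0Semigroup.IsCompact (S : C0Semigroup 𝕜 X) : Prop :=
  ∀ t : ℝ, 0 < t → IsCompactOperator (S t)

/-- `y` is a mild solution on `[0, T]` of `y' = A y + B u + N(t, y)`, `y(0) = y₀`, where `A`
generates `S`. -/
def IsMildSolution (S : C0Semigroup 𝕜 X) (B : U →L[𝕜] X) (N : ℝ → X → X) (T : ℝ)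
    (y₀ : X) (u : ℝ → U) (y : ℝ → X) : Prop :=
  ContinuousOn y (Icc 0 T) ∧
    ∀ t ∈ Icc (0 : ℝ) T, y t = S t y₀ + ∫ s in (0 : ℝ)..t, S (t - s) (B (u s) + N s (y s))

/-- Approximate controllability on `[0, T]` of `y' = A y + B u + N(t, y)`, with controls in
`L²([0, T], U)`. -/
def ApproximatelyControllable (S : C0Semigroup 𝕜 X) (B : U →L[𝕜] X) (N : ℝ → X → X)
    (T : ℝ) : Prop :=
  ∀ y₀ yf : X, ∀ ε : ℝ, 0 < ε →
    ∃ (u : ℝ → U) (y : ℝ → X), MemLp u 2 (volume.restrict (Icc 0 T)) ∧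
      IsMildSolution S B N T y₀ u y ∧ y 0 = y₀ ∧ ‖y T - yf‖ < ε

/-- Finite-approximate controllability on `[0, T]` of `y' = A y + B u + N(t, y)` with respect to
the finite-dimensional subspace `M`. -/
def FiniteApproximatelyControllable (S : C0Semigroup 𝕜 X) (B : U →L[𝕜] X) (N : ℝ → X → X)
    (T : ℝ) (M : Submodule 𝕜 X) [FiniteDimensional 𝕜 M] : Prop :=
  ∀ y₀ yf : X, ∀ ε : ℝ, 0 < ε →
    ∃ (u : ℝ → U) (y : ℝ → X), MemLp u 2 (volume.restrict (Icc 0 T)) ∧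
      IsMildSolution S B N T y₀ u y ∧ y 0 = y₀ ∧ ‖y T - yf‖ < ε ∧
      M.starProjection (y T) = M.starProjection yf

end

section

variable (𝕜 : Type*) {X : Type*} [RCLike 𝕜] [NormedAddCommGroup X] [InnerProductSpace 𝕜 X]

/-- `f` is continuous on `[0, T] × X` and has a Fréchet derivative in the state variable which is
continuous (into the bounded operators with the operator norm) and uniformly bounded there. -/
def HasBoundedC1State (f : ℝ → X → X) (T : ℝ) : Prop :=
  ContinuousOn (fun p : ℝ × X => f p.1 p.2) (Icc 0 T ×ˢ univ) ∧
    (∀ t ∈ Icc (0 : ℝ) T, Differentiable 𝕜 (f t)) ∧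
    ContinuousOn (fun p : ℝ × X => fderiv 𝕜 (f p.1) p.2) (Icc 0 T ×ˢ univ) ∧
    ∃ L : ℝ, 0 < L ∧ ∀ t ∈ Icc (0 : ℝ) T, ∀ z : X, ‖fderiv 𝕜 (f t) z‖ ≤ L

end

/-- `g` is continuous on `[0, T] × X` and `‖g(t, z)‖ ≤ m(t)` for a continuous `m ≥ 0`. -/
def IsContinuousDominated {X : Type*} [NormedAddCommGroup X] (g : ℝ → X → X) (T : ℝ) : Prop :=
  ContinuousOn (fun p : ℝ × X => g p.1 p.2) (Icc 0 T ×ˢ univ) ∧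
    ∃ m : ℝ → ℝ, ContinuousOn m (Icc 0 T) ∧ (∀ t ∈ Icc (0 : ℝ) T, 0 ≤ m t) ∧
      ∀ t ∈ Icc (0 : ℝ) T, ∀ z : X, ‖g t z‖ ≤ m t

/-!
Let `R` be the space of trajectories of `y' = A y + B u` starting at `0`, inside `C([0, T], X)`.
Approximate controllability of `y' = A y + B u + G y` for rank-one constant feedbacks `G` forces the
whole convolution `t ↦ ∫₀ᵗ S (t - s) k(s) ds` of any continuous `k` into the closure of `R`, not
only its terminal value: a functional on `C([0, T], X)` that annihilates the primitives of the
orbits of `B u` for all `u` yields `P : X →L[𝕜] 𝕜` vanishing on the range of `B` with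
`d/dt P (S t x) = a (S t x)` for a bounded functional `a`; if `P v = 1`, the feedback
`G = -(a ⊗ v)` makes `P` vanish along every trajectory from `0`, so `v` cannot be approached.

Hence, for a trajectory `z` of the linear control system, the equation
`y = z + Φ y + r` with `Φ y = ∫₀ᵗ S (t - s) N(s, y(s)) ds` and `r ∈ R` is solvable with `y` close to
`z` and `π_M y(T) = π_M z(T)`: since `S` is compact, `Φ` (with `N` cut off away from `z`) has
relatively compact range in the closure of `R`, so `Φ y` is approximated by a continuous selection
`w(Φ y) ∈ R`, and the small discrepancy in `π_M` is repaired by an element of `R` depending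
continuously on it, as `y ↦ π_M y(T)` maps `R` onto `M`. Schauder's theorem gives the fixed point.
-/

/-! ### Fixed points -/

section Brouwer

section Perturbation

variable {E : Type*} [NormedAddCommGroup E] [NormedSpace ℝ E]

theorem lipschitzWith_indicator_of_frontier {s : Set E} (hs : IsClosed s) {h : E → E} {C : NNReal}
    (hh : LipschitzOnWith C h s) (h0 : ∀ x ∈ frontier s, h x = 0) :
    LipschitzWith C (s.indicator h) := by
  have norm_le : ∀ x ∈ s, ∀ y ∉ s, ‖h x‖ ≤ C * dist x y := by
    intro x hx y hy
    obtain ⟨z, hz, hzs⟩ : ∃ z ∈ segment ℝ x y, z ∈ frontier s := by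
      by_contra! hfr
      have hxy : segment ℝ x y ⊆ interior s ∪ sᶜ := fun z hz => by
        by_cases hzs : z ∈ s
        · exact .inl (by_contra fun hzi => hfr z hz ⟨subset_closure hzs, hzi⟩)
        · exact .inr hzs
      have hxi : x ∈ interior s :=
        (hxy (left_mem_segment ℝ x y)).resolve_right (not_not_intro hx)
      obtain ⟨z, -, hzi, hzs⟩ := (convex_segment (𝕜 := ℝ) x y).isPreconnected _ _ isOpen_interior
        hs.isOpen_compl hxy ⟨x, left_mem_segment ℝ x y, hxi⟩ ⟨y, right_mem_segment ℝ x y, hy⟩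
      exact hzs (interior_subset hzi)
    calc ‖h x‖ = dist (h x) (h z) := by rw [h0 z hzs, dist_zero_right]
      _ ≤ C * dist x z := hh.dist_le_mul x hx z (hs.frontier_subset hzs)
      _ ≤ C * dist x y := by
        gcongr
        linarith [dist_add_dist_of_mem_segment hz, dist_nonneg (x := z) (y := y)]
  refine LipschitzWith.of_dist_le_mul fun x y => ?_
  by_cases hx : x ∈ s <;> by_cases hy : y ∈ s
  · simpa [hx, hy] using hh.dist_le_mul x hx y hy
  · simpa [hx, hy] using norm_le x hx y hy
  · simpa [hx, hy, dist_comm] using norm_le y hy x hx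
  · simpa [hx, hy] using by positivity

theorem bijOn_add_of_lipschitzOnWith_of_frontier [CompleteSpace E] {s : Set E} (hs : IsClosed s)
    {h : E → E} {C : NNReal} (hC : C < 1) (hh : LipschitzOnWith C h s)
    (h0 : ∀ x ∈ frontier s, h x = 0) : BijOn (fun x => x + h x) s s := by
  let H : E → E := fun x => x + s.indicator h x
  have hH : ApproximatesLinearOn H (ContinuousLinearEquiv.refl ℝ E : E →L[ℝ] E) univ C := by
    intro x _ y _
    have hdiff : H x - H y - (x - y) = s.indicator h x - s.indicator h y := by
      simp only [H]; abel
    simpa [hdiff, dist_eq_norm] using (lipschitzWith_indicator_of_frontier hs hh h0).dist_le_mul x y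
  have hC' : Subsingleton E ∨
      C < ‖((ContinuousLinearEquiv.refl ℝ E).symm : E →L[ℝ] E)‖₊⁻¹ := by
    rcases subsingleton_or_nontrivial E with hE | hE
    · exact .inl hE
    · have hone : ‖((ContinuousLinearEquiv.refl ℝ E).symm : E →L[ℝ] E)‖₊ = 1 :=
        NNReal.eq ContinuousLinearMap.norm_id
      exact .inr (by rwa [hone, inv_one])
  have hinj : Function.Injective H := injOn_univ.1 (hH.injOn hC')
  have hfix : ∀ x ∉ s, H x = x := fun x hx => by simp [H, hx]
  refine BijOn.congr ⟨fun x hx => ?_, hinj.injOn, fun y hy => ?_⟩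
    (fun x hx => by simp [H, hx] : EqOn H (fun x => x + h x) s)
  · by_contra hHx
    exact hHx ((hinj (hfix _ hHx)).symm ▸ hx)
  · obtain ⟨x, rfl⟩ := hH.surjective hC' y
    refine ⟨x, by_contra fun hx => hx ?_, rfl⟩
    rwa [hfix x hx] at hy

end Perturbation

section Determinant

variable {E : Type*} [NormedAddCommGroup E] [NormedSpace ℝ E] [FiniteDimensional ℝ E]

theorem det_one_add_pos_of_norm_lt_one {L : E →L[ℝ] E} (hL : ‖L‖ < 1) :
    0 < (1 + L).det := by
  have hcont : ContinuousOn (fun s : ℝ => (1 + s • L).det) (Icc 0 1) :=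
    (ContinuousLinearMap.continuous_det.comp (by fun_prop)).continuousOn
  have hne : ∀ s ∈ Icc (0 : ℝ) 1, (1 + s • L).det ≠ 0 := by
    intro s hs
    have hsL : ‖-(s • L)‖ < 1 := by
      rw [norm_neg, norm_smul, Real.norm_of_nonneg hs.1]
      exact (mul_le_of_le_one_left (norm_nonneg L) hs.2).trans_lt hL
    have hunit : IsUnit (1 + s • L) := by simpa using isUnit_one_sub_of_norm_lt_one hsL
    exact ((LinearMap.isUnit_iff_isUnit_det _).1
      (hunit.map (ContinuousLinearMap.toLinearMapRingHom : (E →L[ℝ] E) →+* (E →ₗ[ℝ] E)))).ne_zero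
  by_contra! hle
  obtain ⟨s, hs, hs0⟩ := intermediate_value_Icc' zero_le_one hcont
    (show (0 : ℝ) ∈ Icc _ _ from ⟨by simpa using hle, by simp [ContinuousLinearMap.det]⟩)
  exact hne s hs hs0

theorem exists_polynomial_eval_eq_det_one_add_smul (L : E →L[ℝ] E) :
    ∃ p : Polynomial ℝ, p.natDegree ≤ Module.finrank ℝ E ∧
      ∀ t : ℝ, p.eval t = (1 + t • L).det := by
  let b := Module.finBasis ℝ E
  let A := LinearMap.toMatrix b b (L : E →ₗ[ℝ] E)
  refine ⟨((Polynomial.X : Polynomial ℝ) • A.map Polynomial.C +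
    (1 : Matrix _ _ ℝ).map Polynomial.C).det, ?_, fun t => ?_⟩
  · simpa using Polynomial.natDegree_det_X_add_C_le A 1
  · have hA : LinearMap.toMatrix b b ((1 + t • L : E →L[ℝ] E) : E →ₗ[ℝ] E) = 1 + t • A := by
      rw [← LinearMap.toMatrix_id b, ← map_smul, ← map_add]
      rfl
    rw [← Polynomial.coe_evalRingHom, RingHom.map_det, ContinuousLinearMap.det,
      ← LinearMap.det_toMatrix b, hA]
    congr 1
    ext i j
    by_cases h : i = j <;> simp [h, add_comm, mul_comm t]

theorem exists_polynomial_eval_eq_integral_det_one_add_smul {α : Type*} [MeasurableSpace α]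
    {μ : Measure α} {L : α → E →L[ℝ] E}
    (hL : ∀ t : ℝ, Integrable (fun x => (1 + t • L x).det) μ) :
    ∃ p : Polynomial ℝ, ∀ t : ℝ, p.eval t = ∫ x, (1 + t • L x).det ∂μ := by
  let nodes := Finset.range (Module.finrank ℝ E + 1)
  let v : ℕ → ℝ := fun i => i
  have hv : InjOn v nodes := Nat.cast_injective.injOn
  have interpolate : ∀ x t, (1 + t • L x).det =
      ∑ i ∈ nodes, (1 + v i • L x).det * (Lagrange.basis nodes v i).eval t := by
    intro x t
    obtain ⟨p, hp, heval⟩ := exists_polynomial_eval_eq_det_one_add_smul (L x)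
    have hdeg : p.degree < nodes.card := by
      rw [Finset.card_range]
      exact Polynomial.degree_le_natDegree.trans_lt (by exact_mod_cast Nat.lt_succ_of_le hp)
    rw [← heval t, Lagrange.eq_interpolate hv hdeg]
    simp [Lagrange.interpolate_apply, Polynomial.eval_finsetSum, heval]
  refine ⟨Lagrange.interpolate nodes v fun i => ∫ x, (1 + v i • L x).det ∂μ, fun t => ?_⟩
  simp_rw [interpolate _ t]
  rw [integral_finsetSum _ fun i _ => (hL (v i)).mul_const _]
  simp_rw [integral_mul_const]
  simp [Lagrange.interpolate_apply, Polynomial.eval_finsetSum]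

end Determinant

section Volume

variable {E : Type*} [NormedAddCommGroup E] [NormedSpace ℝ E] [FiniteDimensional ℝ E]
  [MeasurableSpace E] [BorelSpace E] (μ : Measure E) [μ.IsAddHaarMeasure]

theorem setIntegral_det_one_add_fderiv_eq_measureReal {K : Set E} (hK : IsClosed K)
    (hconv : Convex ℝ K) {h : E → E} (hh : Differentiable ℝ h) (h0 : ∀ x ∈ frontier K, h x = 0)
    {C : NNReal} (hC : C < 1) (hle : ∀ x ∈ K, ‖fderiv ℝ h x‖₊ ≤ C) :
    ∫ x in K, (1 + fderiv ℝ h x).det ∂μ = μ.real K := by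
  have hbij : BijOn (fun x => x + h x) K K :=
    bijOn_add_of_lipschitzOnWith_of_frontier hK hC
      (hconv.lipschitzOnWith_of_nnnorm_fderiv_le (fun x _ => hh x) hle) h0
  have hderiv : ∀ x ∈ K, HasFDerivWithinAt (fun x => x + h x) (1 + fderiv ℝ h x) K x :=
    fun x _ => ((hasFDerivAt_id x).add (hh x).hasFDerivAt).hasFDerivWithinAt
  have hvol := integral_image_eq_integral_abs_det_fderiv_smul μ hK.measurableSet hderiv
    hbij.injOn fun _ => (1 : ℝ)
  rw [hbij.image_eq] at hvol
  simp only [integral_const, smul_eq_mul, mul_one, measureReal_restrict_apply_univ] at hvol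
  rw [hvol]
  refine setIntegral_congr_fun hK.measurableSet fun x hx => (abs_of_pos ?_).symm
  exact det_one_add_pos_of_norm_lt_one ((NNReal.coe_le_coe.2 (hle x hx)).trans_lt hC)

-- With `h = G - id`, the map `id + t • h` is a bijection of `K` for small `t ≥ 0`, so the
-- polynomial `t ↦ ∫ x in K, det (1 + t • Dh x)` is constantly the volume of `K`; take `t = 1`.
theorem setIntegral_det_fderiv_eq_measureReal {K : Set E} (hK : IsCompact K) (hconv : Convex ℝ K)
    {G : E → E} (hG : ContDiff ℝ 1 G) (hid : ∀ x ∈ frontier K, G x = x) :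
    ∫ x in K, (fderiv ℝ G x).det ∂μ = μ.real K := by
  let h : E → E := fun x => G x - x
  have hh : ContDiff ℝ 1 h := hG.sub contDiff_id
  have hdh : ∀ x, fderiv ℝ h x = fderiv ℝ G x - 1 := fun x =>
    ((hG.differentiable one_ne_zero x).hasFDerivAt.sub (hasFDerivAt_id x)).fderiv
  have hcont : Continuous (fderiv ℝ h) := hh.continuous_fderiv one_ne_zero
  obtain ⟨p, hp⟩ := exists_polynomial_eval_eq_integral_det_one_add_smul (μ := μ.restrict K)
    (L := fderiv ℝ h) fun t => (ContinuousLinearMap.continuous_det.comp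
      (continuous_const.add (hcont.const_smul t))).continuousOn.integrableOn_compact hK
  obtain ⟨C, hC⟩ := hK.bddAbove_image hcont.nnnorm.continuousOn
  have hsmall : ∀ t ∈ Ioo 0 (C + 1)⁻¹, p.eval (t : ℝ) = μ.real K := by
    intro t ht
    have htC : t * C < 1 :=
      (mul_le_mul_right le_self_add t).trans_lt ((NNReal.lt_inv_iff_mul_lt (by positivity)).1 ht.2)
    have hfd : ∀ x, fderiv ℝ (fun x => (t : ℝ) • h x) x = (t : ℝ) • fderiv ℝ h x := fun x =>
      ((hh.differentiable one_ne_zero x).hasFDerivAt.const_smul (t : ℝ)).fderiv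
    have hvol := setIntegral_det_one_add_fderiv_eq_measureReal μ hK.isClosed hconv
      (h := fun x => (t : ℝ) • h x) ((hh.differentiable one_ne_zero).const_smul (t : ℝ))
      (fun x hx => by simp [h, hid x hx]) htC fun x hx => by
        rw [hfd, nnnorm_smul, NNReal.nnnorm_eq]
        exact mul_le_mul_right (hC (mem_image_of_mem _ hx)) t
    simp_rw [hfd] at hvol
    rw [hp, hvol]
  have hconst : p = Polynomial.C (μ.real K) :=
    Polynomial.eq_of_infinite_eval_eq _ _ <|
      ((Ioo_infinite (inv_pos.2 (by positivity : 0 < C + 1))).image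
        NNReal.coe_injective.injOn).mono <|
          image_subset_iff.2 fun t ht => by simpa using hsmall t ht
  simpa [hconst, hdh] using (hp 1).symm

end Volume

section Euclidean

variable {E : Type*} [NormedAddCommGroup E] [InnerProductSpace ℝ E] [FiniteDimensional ℝ E]

theorem det_eq_zero_of_norm_eq_const {G : E → E} {x : E} {L : E →L[ℝ] E}
    (hG : HasFDerivAt G L x) {r : ℝ} (hr : r ≠ 0) (hconst : ∀ y, ‖G y‖ = r) : L.det = 0 := by
  have horth : ∀ v, inner ℝ (G x) (L v) = 0 := fun v => by
    have hsq : HasFDerivAt (fun y => ‖G y‖ ^ 2) (0 : E →L[ℝ] ℝ) x := by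
      simpa only [hconst] using hasFDerivAt_const (r ^ 2) x
    simpa using congr($(hG.norm_sq.unique hsq) v)
  by_contra hdet
  have hunit : IsUnit (L : E →ₗ[ℝ] E) :=
    (LinearMap.isUnit_iff_isUnit_det _).2 (isUnit_iff_ne_zero.2 hdet)
  obtain ⟨v, hv⟩ := ((Module.End.isUnit_iff _).1 hunit).2 (G x)
  have hGx : G x = 0 := by simpa [show L v = G x from hv] using horth v
  exact hr (by rw [← hconst x, hGx, norm_zero])

theorem not_contDiff_retraction_sphere {R : ℝ} (hR : 0 < R) {G : E → E} (hG : ContDiff ℝ 1 G)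
    (hid : ∀ x, ‖x‖ = R → G x = x) : ¬ ∀ x, ‖G x‖ = R := by
  intro hsphere
  borelize E
  have hvol := setIntegral_det_fderiv_eq_measureReal volume (isCompact_closedBall (0 : E) R)
    (convex_closedBall 0 R) hG fun x hx =>
      hid x (by simpa using Metric.frontier_closedBall_subset_sphere hx)
  have hdet : ∀ x, (fderiv ℝ G x).det = 0 := fun x =>
    det_eq_zero_of_norm_eq_const (hG.differentiable one_ne_zero x).hasFDerivAt hR.ne' hsphere
  simp only [hdet, integral_zero] at hvol
  have hpos : 0 < volume.real (Metric.closedBall (0 : E) R) :=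
    ENNReal.toReal_pos (Metric.measure_closedBall_pos _ _ hR).ne' measure_closedBall_lt_top.ne
  exact hpos.ne hvol

theorem exists_fixedPoint_of_contDiff_of_norm_le {φ : E → E} (hφ : ContDiff ℝ 1 φ)
    {r : ℝ} (hr : 0 < r) (hb : ∀ x, ‖φ x‖ ≤ r) : ∃ x, φ x = x := by
  by_contra! hne
  let χ : ContDiffBump (0 : E) := ⟨r, 2 * r, hr, by linarith⟩
  let F : E → E := fun x => x - χ x • φ x
  have hF : ContDiff ℝ 1 F := contDiff_id.sub (χ.contDiff.smul hφ)
  have hF0 : ∀ x, F x ≠ 0 := by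
    intro x hx
    have hx' : x = χ x • φ x := sub_eq_zero.1 hx
    have hxr : ‖x‖ ≤ r := by
      rw [hx', norm_smul, Real.norm_of_nonneg χ.nonneg]
      exact (mul_le_of_le_one_left (norm_nonneg _) χ.le_one).trans (hb x)
    rw [χ.one_of_mem_closedBall (by simpa [χ] using hxr), one_smul] at hx'
    exact hne x hx'.symm
  refine not_contDiff_retraction_sphere (G := fun x => (2 * r * ‖F x‖⁻¹) • F x)
    (show 0 < 2 * r by linarith) ?_ (fun x hx => ?_) fun x => ?_
  · exact (contDiff_const.mul ((hF.norm ℝ hF0).inv fun x => norm_ne_zero_iff.2 (hF0 x))).smul hF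
  · have hFx : F x = x := by
      simp only [F]
      rw [χ.zero_of_le_dist (by simp [χ, hx]), zero_smul, sub_zero]
    rw [hFx, hx, mul_inv_cancel₀ (by linarith), one_smul]
  · rw [norm_smul, norm_mul, norm_inv, norm_norm, mul_assoc,
      inv_mul_cancel₀ (norm_ne_zero_iff.2 (hF0 x)), mul_one, Real.norm_of_nonneg (by linarith)]

end Euclidean

theorem exists_fixedPoint_of_forall_exists_dist_lt {α : Type*} [MetricSpace α] {Φ : α → α}
    (hΦ : Continuous Φ) (hcpt : IsCompact (closure (range Φ)))
    (happ : ∀ ε > 0, ∃ x, dist x (Φ x) < ε) : ∃ x, Φ x = x := by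
  choose x hx using fun n : ℕ => happ (1 / (n + 1)) (by positivity)
  obtain ⟨p, -, s, hs, hlim⟩ :=
    hcpt.tendsto_subseq fun n => subset_closure (mem_range_self (x n))
  have hdist : Tendsto (fun n => dist (x (s n)) (Φ (x (s n)))) atTop (𝓝 0) :=
    squeeze_zero (fun _ => dist_nonneg) (fun n => (hx (s n)).le)
      (tendsto_one_div_add_atTop_nhds_zero_nat.comp hs.tendsto_atTop)
  have hx_lim : Tendsto (fun n => x (s n)) atTop (𝓝 p) := by
    refine hlim.congr_dist ?_
    simpa only [Function.comp_apply, dist_comm] using hdist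
  exact ⟨p, tendsto_nhds_unique ((hΦ.tendsto p).comp hx_lim) hlim⟩

theorem exists_fixedPoint_of_continuous_of_norm_le {E : Type*} [NormedAddCommGroup E]
    [InnerProductSpace ℝ E] [FiniteDimensional ℝ E] {φ : E → E} (hφ : Continuous φ) {r : ℝ}
    (hb : ∀ x, ‖φ x‖ ≤ r) : ∃ x, φ x = x := by
  have hr : 0 ≤ r := (norm_nonneg _).trans (hb 0)
  have hbdd : Bornology.IsBounded (range φ) :=
    isBounded_iff_forall_norm_le.2 ⟨r, forall_mem_range.2 hb⟩
  refine exists_fixedPoint_of_forall_exists_dist_lt hφ hbdd.isCompact_closure fun ε hε => ?_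
  obtain ⟨ψ, hψ, hdist, -⟩ :=
    hφ.exists_contDiff_approx 1 (continuous_const (y := ε)) fun _ => hε
  have hψb : ∀ x, ‖ψ x‖ ≤ r + ε := fun x => by
    linarith [norm_le_norm_add_norm_sub' (ψ x) (φ x), dist_eq_norm (ψ x) (φ x), hdist x, hb x]
  obtain ⟨x, hx⟩ := exists_fixedPoint_of_contDiff_of_norm_le hψ (by positivity) hψb
  exact ⟨x, by simpa [hx] using hdist x⟩

theorem brouwer_exists_fixedPoint {E : Type*} [NormedAddCommGroup E]
    [NormedSpace ℝ E] [FiniteDimensional ℝ E] {φ : E → E} (hφ : Continuous φ)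
    (hb : Bornology.IsBounded (range φ)) : ∃ x, φ x = x := by
  let e := toEuclidean (E := E)
  obtain ⟨r, hr⟩ := isBounded_iff_forall_norm_le.1 (e.lipschitz.isBounded_image hb)
  obtain ⟨x, hx⟩ := exists_fixedPoint_of_continuous_of_norm_le (φ := fun v => e (φ (e.symm v)))
    (r := r) (by fun_prop) fun v => hr _ (mem_image_of_mem e (mem_range_self _))
  exact ⟨e.symm x, by rw [← e.symm_apply_apply (φ (e.symm x)), hx]⟩

end Brouwer

section Schauder

variable {E : Type*} [NormedAddCommGroup E] [NormedSpace ℝ E]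

theorem exists_continuousMap_mem_dist_lt {α : Type*} [TopologicalSpace α] [NormalSpace α]
    [ParacompactSpace α] {f : α → E} (hf : Continuous f) {s : Set E} (hs : Convex ℝ s) {η : ℝ}
    (hfs : ∀ a, ∃ c ∈ s, dist c (f a) < η) :
    ∃ w : C(α, E), ∀ a, w a ∈ s ∧ dist (w a) (f a) < η := by
  refine exists_continuous_forall_mem_convex_of_local_const
    (t := fun a => s ∩ Metric.ball (f a) η) (fun a => hs.inter (convex_ball _ _)) fun a => ?_
  obtain ⟨c, hcs, hc⟩ := hfs a
  exact ⟨c, ((continuous_const.dist hf).continuousAt.eventually_lt_const hc).mono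
    fun _ hb => ⟨hcs, hb⟩⟩

theorem schauder_exists_fixedPoint {Φ : E → E} (hΦ : Continuous Φ)
    (hcpt : IsCompact (closure (range Φ))) : ∃ x, Φ x = x := by
  refine exists_fixedPoint_of_forall_exists_dist_lt hΦ hcpt fun ε hε => ?_
  obtain ⟨t, ht, hcover⟩ := Metric.totallyBounded_iff.1 hcpt.totallyBounded ε hε
  have : CompactSpace (closure (range Φ)) := isCompact_iff_compactSpace.1 hcpt
  have hR : FiniteDimensional ℝ (Submodule.span ℝ t) := .span_of_finite ℝ ht
  obtain ⟨w, hw⟩ := exists_continuousMap_mem_dist_lt (f := ((↑) : closure (range Φ) → E))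
    continuous_subtype_val (Submodule.span ℝ t).convex fun q => by
      obtain ⟨c, hc, hqc⟩ := mem_iUnion₂.1 (hcover q.2)
      exact ⟨c, Submodule.subset_span hc, Metric.mem_ball'.1 hqc⟩
  let Q : E → closure (range Φ) := fun x => ⟨Φ x, subset_closure (mem_range_self x)⟩
  let φ : Submodule.span ℝ t → Submodule.span ℝ t := fun x => ⟨w (Q x), (hw _).1⟩
  obtain ⟨x, hx⟩ := brouwer_exists_fixedPoint (φ := φ)
    ((w.continuous.comp ((hΦ.comp continuous_subtype_val).subtype_mk _)).subtype_mk _) <| by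
      refine Bornology.isBounded_image_subtype_val.1
        ((isCompact_range w.continuous).isBounded.subset ?_)
      rw [← range_comp]
      exact range_subset_iff.2 fun x => mem_range_self _
  refine ⟨x, ?_⟩
  have hxw : (x : E) = w (Q x) := congr_arg Subtype.val hx.symm
  simpa only [← hxw] using (hw (Q x)).2

end Schauder

section FixedPointModulo

variable {𝕜 E F : Type*} [RCLike 𝕜] [NormedAddCommGroup E] [NormedSpace 𝕜 E]
  [NormedAddCommGroup F] [NormedSpace 𝕜 F] [FiniteDimensional 𝕜 F]

theorem exists_clm_sub_mem_of_map_eq_top {D : Submodule 𝕜 E} {ℓ : E →L[𝕜] F}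
    (hℓ : D.map (ℓ : E →ₗ[𝕜] F) = ⊤) :
    ∃ p : E →L[𝕜] E, (∀ x, x - p x ∈ D) ∧ ∀ x, ℓ (p x) = 0 := by
  have hsurj : Function.Surjective ((ℓ : E →ₗ[𝕜] F).domRestrict D) := by
    rw [← LinearMap.range_eq_top, LinearMap.range_domRestrict, hℓ]
  obtain ⟨Λ, hΛ⟩ := ((ℓ : E →ₗ[𝕜] F).domRestrict D).exists_rightInverse_of_surjective
    (LinearMap.range_eq_top.2 hsurj)
  let Λ' : F →L[𝕜] E := LinearMap.toContinuousLinearMap (D.subtype ∘ₗ Λ)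
  refine ⟨ContinuousLinearMap.id 𝕜 E - Λ'.comp ℓ, fun x => ?_, fun x => ?_⟩
  · simp [Λ']
  · have hΛx : ℓ (Λ (ℓ x)) = ℓ x := congr($hΛ (ℓ x))
    simp [Λ', hΛx]

theorem map_eq_top_of_dense {D : Submodule 𝕜 E} (hD : Dense (D : Set E)) {ℓ : E →L[𝕜] F}
    (hℓ : Function.Surjective ℓ) : D.map (ℓ : E →ₗ[𝕜] F) = ⊤ := by
  have hdense : Dense ((D.map (ℓ : E →ₗ[𝕜] F)) : Set F) := by
    simpa using hℓ.denseRange.dense_image ℓ.continuous hD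
  exact SetLike.coe_injective (by
    rw [← (Submodule.closed_of_finiteDimensional _).closure_eq, hdense.closure_eq]; rfl)

theorem exists_mem_map_eq_norm_sub_lt {D : Submodule 𝕜 E} (hD : Dense (D : Set E)) {ℓ : E →L[𝕜] F}
    (hℓ : Function.Surjective ℓ) (x : E) {ε : ℝ} (hε : 0 < ε) :
    ∃ d ∈ D, ℓ d = ℓ x ∧ ‖d - x‖ < ε := by
  obtain ⟨p, hpD, hp⟩ := exists_clm_sub_mem_of_map_eq_top (map_eq_top_of_dense hD hℓ)
  obtain ⟨d₀, hd₀, hd₀D⟩ := Metric.dense_iff.1 hD x (ε / (‖p‖ + 1)) (by positivity)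
  rw [Metric.mem_ball, dist_eq_norm, lt_div_iff₀ (by positivity)] at hd₀
  refine ⟨x + p (d₀ - x), ?_, by simp [hp], ?_⟩
  · convert D.sub_mem hd₀D (hpD (d₀ - x)) using 1
    abel
  · rw [add_sub_cancel_left]
    linarith [p.le_opNorm (d₀ - x), norm_nonneg (d₀ - x)]

theorem exists_sub_mem_map_eq_norm_sub_lt [NormedSpace ℝ E] [IsScalarTower ℝ 𝕜 E]
    {D : Submodule 𝕜 E} {ℓ : E →L[𝕜] F} (hℓ : D.map (ℓ : E →ₗ[𝕜] F) = ⊤) {Φ : E → E}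
    (hΦ : Continuous Φ) (hcpt : IsCompact (closure (range Φ))) (hD : ∀ x, Φ x ∈ closure (D : Set E))
    (z : E) {ε : ℝ} (hε : 0 < ε) : ∃ y, y - Φ y - z ∈ D ∧ ℓ y = ℓ z ∧ ‖y - z‖ < ε := by
  obtain ⟨p, hpD, hp⟩ := exists_clm_sub_mem_of_map_eq_top hℓ
  have : CompactSpace (closure (range Φ)) := isCompact_iff_compactSpace.1 hcpt
  obtain ⟨w, hw⟩ := exists_continuousMap_mem_dist_lt (f := ((↑) : closure (range Φ) → E))
    continuous_subtype_val (D.restrictScalars ℝ).convex (η := ε / (‖p‖ + 1)) fun q => by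
      obtain ⟨c, hc, hqc⟩ := Metric.mem_closure_iff.1
        (closure_minimal (range_subset_iff.2 hD) isClosed_closure q.2) (ε / (‖p‖ + 1))
        (by positivity)
      exact ⟨c, hc, by rwa [dist_comm]⟩
  let Q : E → closure (range Φ) := fun x => ⟨Φ x, subset_closure (mem_range_self x)⟩
  let Ψ : closure (range Φ) → E := fun q => z + p (q - w q)
  have hΨ : Continuous Ψ := by fun_prop
  obtain ⟨y, hy⟩ := schauder_exists_fixedPoint (Φ := fun x => Ψ (Q x))
    (hΨ.comp (hΦ.subtype_mk _)) <| (isCompact_range hΨ).closure_of_subset <|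
      range_subset_iff.2 fun x => mem_range_self _
  have hyz : y - z = p (Φ y - w (Q y)) := sub_eq_iff_eq_add'.2 hy.symm
  refine ⟨y, ?_, ?_, ?_⟩
  · convert D.neg_mem (D.add_mem (hw (Q y)).1 (hpD (Φ y - w (Q y)))) using 1
    rw [← hyz]
    abel
  · rw [← sub_eq_zero, ← map_sub, hyz, hp]
  · have hdist := (hw (Q y)).2
    rw [dist_comm, dist_eq_norm, lt_div_iff₀ (by positivity)] at hdist
    rw [hyz]
    linarith [p.le_opNorm (Φ y - w (Q y)), norm_nonneg (Φ y - w (Q y))]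

end FixedPointModulo

/-! ### Convolution with a semigroup -/

theorem isCompact_closure_of_equicontinuous {α β : Type*} [TopologicalSpace α] [CompactSpace α]
    [MetricSpace β] {A : Set C(α, β)} {s : Set β} (hs : IsCompact s)
    (hAs : ∀ y ∈ A, ∀ a, y a ∈ s) (hA : Equicontinuous ((↑) : A → α → β)) :
    IsCompact (closure A) := by
  let e := (ContinuousMap.isometryEquivBoundedOfCompact α β).toHomeomorph
  rw [← e.isCompact_image, e.image_closure]
  refine BoundedContinuousFunction.arzela_ascoli s hs _ ?_ fun a U hU => ?_
  · rintro _ a ⟨y, hy, rfl⟩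
    exact hAs y hy a
  · filter_upwards [hA a U hU] with b hb
    rintro ⟨_, y, hy, rfl⟩
    exact hb ⟨y, hy⟩

namespace C0Semigroup

variable {𝕜 X : Type*} [RCLike 𝕜] [NormedAddCommGroup X] [InnerProductSpace 𝕜 X]

section Continuity

variable [CompleteSpace X] (S : C0Semigroup 𝕜 X)

theorem exists_forall_norm_le (T : ℝ) : ∃ C, 0 ≤ C ∧ ∀ t ∈ Icc 0 T, ‖S t‖ ≤ C := by
  obtain ⟨C, hC⟩ := banach_steinhaus (g := fun t : Icc (0 : ℝ) T => S t) fun x => by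
    obtain ⟨D, hD⟩ := isCompact_Icc.exists_bound_of_continuousOn
      ((S.strong_continuity x).mono (Icc_subset_Ici_self : Icc (0 : ℝ) T ⊆ _))
    exact ⟨D, fun t => hD t t.2⟩
  exact ⟨max C 0, le_max_right _ _, fun t ht => (hC ⟨t, ht⟩).trans (le_max_left _ _)⟩

theorem continuous_uncurry_max : Continuous fun p : ℝ × X => S (max p.1 0) p.2 := by
  refine continuous_iff_continuousAt.2 fun ⟨t₀, x₀⟩ => ?_
  obtain ⟨C, -, hC⟩ := S.exists_forall_norm_le (|t₀| + 1)
  have hstate : Tendsto (fun p : ℝ × X => S (max p.1 0) (p.2 - x₀)) (𝓝 (t₀, x₀)) (𝓝 0) := by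
    refine squeeze_zero_norm' (a := fun p : ℝ × X => C * ‖p.2 - x₀‖) ?_ ?_
    · have hlt : ∀ᶠ p : ℝ × X in 𝓝 (t₀, x₀), p.1 < |t₀| + 1 :=
        continuous_fst.continuousAt.eventually_lt_const (by linarith [le_abs_self t₀])
      filter_upwards [hlt] with p hp
      exact (S _).le_of_opNorm_le (hC _ ⟨le_max_right _ _, max_le hp.le (by positivity)⟩) _
    · have hcont : Continuous fun p : ℝ × X => C * ‖p.2 - x₀‖ := by fun_prop
      simpa using hcont.tendsto (t₀, x₀)
  have htime : Continuous fun p : ℝ × X => S (max p.1 0) x₀ :=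
    (S.strong_continuity x₀).comp_continuous (by fun_prop) fun p => mem_Ici.2 (le_max_right _ _)
  have hsum := hstate.add (htime.tendsto (t₀, x₀))
  rw [zero_add] at hsum
  exact hsum.congr fun p => by rw [← _root_.map_add, sub_add_cancel]

theorem exists_forall_norm_apply_sub_lt {Q : Set X} (hQ : _root_.IsCompact Q) {ε : ℝ}
    (hε : 0 < ε) : ∃ δ > 0, ∀ h, 0 ≤ h → h < δ → ∀ x ∈ Q, ‖S h x - x‖ < ε := by
  have hev : ∀ᶠ h : ℝ in 𝓝 0, ∀ x ∈ Q, ‖S (max h 0) x - x‖ < ε := by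
    refine hQ.eventually_forall_of_forall_eventually fun x _ => ?_
    have hc : Continuous fun p : ℝ × X => ‖S (max p.1 0) p.2 - p.2‖ :=
      (S.continuous_uncurry_max.sub continuous_snd).norm
    exact hc.continuousAt.eventually_lt_const (by simp [S.map_zero, hε])
  obtain ⟨δ, hδ, hball⟩ := Metric.eventually_nhds_iff.1 hev
  refine ⟨δ, hδ, fun h h0 hhδ x hx => ?_⟩
  simpa [h0] using hball (y := h) (by rwa [Real.dist_eq, sub_zero, abs_of_nonneg h0]) x hx

end Continuity

section Causal

variable (S : C0Semigroup 𝕜 X)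

/-- The semigroup extended by zero to negative times. It turns the convolution integrals over the
moving intervals `[0, t]`, `t ≤ T`, into integrals over the fixed interval `[0, T]`. -/
noncomputable def causal (r : ℝ) : X →L[𝕜] X := (Ici (0 : ℝ)).indicator S.toFun r

variable {S}

theorem causal_of_nonneg {r : ℝ} (hr : 0 ≤ r) : S.causal r = S r := indicator_of_mem hr _

theorem causal_of_neg {r : ℝ} (hr : r < 0) : S.causal r = 0 := indicator_of_notMem hr.not_ge _

theorem norm_causal_apply_le {T C : ℝ} (hC : ∀ t ∈ Icc 0 T, ‖S t‖ ≤ C) (hC0 : 0 ≤ C) {r : ℝ}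
    (hr : r ≤ T) (x : X) : ‖S.causal r x‖ ≤ C * ‖x‖ := by
  rcases lt_or_ge r 0 with h | h
  · rw [causal_of_neg h]
    simpa using by positivity
  · rw [causal_of_nonneg h]
    exact (S r).le_of_opNorm_le (hC r ⟨h, hr⟩) x

theorem continuousAt_causal_apply (x : X) {r : ℝ} (hr : r ≠ 0) :
    ContinuousAt (fun r => S.causal r x) r := by
  rcases lt_or_gt_of_ne hr with h | h
  · exact continuousAt_const.congr
      ((eventually_lt_nhds h).mono fun t ht => by simp [causal_of_neg ht] :
        ∀ᶠ t in 𝓝 r, 0 = S.causal t x)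
  · exact ((S.strong_continuity x).continuousAt (Ici_mem_nhds h)).congr
      ((eventually_gt_nhds h).mono fun t ht => by simp [causal_of_nonneg (le_of_lt ht)])

theorem aestronglyMeasurable_causal_apply [CompleteSpace X] {α : Type*} [MeasurableSpace α]
    {μ : Measure α} {r : α → ℝ} (hr : Measurable r) {k : α → X} (hk : AEStronglyMeasurable k μ) :
    AEStronglyMeasurable (fun a => S.causal (r a) (k a)) μ := by
  have hS : AEStronglyMeasurable (fun a => S (max (r a) 0) (k a)) μ :=
    S.continuous_uncurry_max.comp_aestronglyMeasurable (hr.aestronglyMeasurable.prodMk hk)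
  refine (hS.indicator (hr measurableSet_Ici : MeasurableSet (r ⁻¹' Ici 0))).congr
    (.of_forall fun a => ?_)
  rcases lt_or_ge (r a) 0 with h | h
  · simp [causal_of_neg h, h.not_ge]
  · simp [causal_of_nonneg h, h]

theorem integrableOn_causal_apply [CompleteSpace X] {T : ℝ} {k : ℝ → X}
    (hk : IntegrableOn k (Icc 0 T)) {t : ℝ} (ht : t ≤ T) :
    IntegrableOn (fun s => S.causal (t - s) (k s)) (Ioc 0 T) := by
  obtain ⟨C, hC0, hC⟩ := S.exists_forall_norm_le T
  have hk' : IntegrableOn k (Ioc 0 T) := hk.mono_set Ioc_subset_Icc_self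
  refine (hk'.norm.const_mul C).mono' (aestronglyMeasurable_causal_apply (by fun_prop) hk'.1) ?_
  exact ae_restrict_of_forall_mem measurableSet_Ioc fun s hs =>
    norm_causal_apply_le hC hC0 (by linarith [hs.1]) _

theorem intervalIntegrable_apply [CompleteSpace X] {T : ℝ} {k : ℝ → X}
    (hk : IntegrableOn k (Icc 0 T)) {a b t : ℝ} (ha : 0 ≤ a) (hab : a ≤ b) (hbt : b ≤ t)
    (htT : t ≤ T) : IntervalIntegrable (fun s => S (t - s) (k s)) volume a b := by
  rw [intervalIntegrable_iff_integrableOn_Ioc_of_le hab]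
  refine ((integrableOn_causal_apply (S := S) hk htT).mono_set
    (Ioc_subset_Ioc ha (hbt.trans htT))).congr_fun (fun s hs => ?_) measurableSet_Ioc
  have hst : 0 ≤ t - s := by linarith [hs.2]
  simp only [causal_of_nonneg hst]

end Causal

section Convolution

variable [NormedSpace ℝ X] (S : C0Semigroup 𝕜 X)

/-- The convolution `t ↦ ∫₀ᵗ S (t - s) k(s) ds`, i.e. the mild solution of `y' = A y + k` with
`y(0) = 0`. -/
noncomputable def conv (k : ℝ → X) (t : ℝ) : X := ∫ s in (0 : ℝ)..t, S (t - s) (k s)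

variable {S}

theorem conv_smul (c : 𝕜) (k : ℝ → X) (t : ℝ) : S.conv (c • k) t = c • S.conv k t := by
  simp only [conv, Pi.smul_apply, map_smul]
  exact intervalIntegral.integral_smul _ _

theorem conv_eq_setIntegral_causal {T : ℝ} (k : ℝ → X) {t : ℝ} (ht : t ∈ Icc 0 T) :
    S.conv k t = ∫ s in Ioc 0 T, S.causal (t - s) (k s) := by
  rw [conv, intervalIntegral.integral_of_le ht.1]
  refine (setIntegral_congr_fun measurableSet_Ioc fun s hs => ?_).trans
    (setIntegral_eq_of_subset_of_forall_sdiff_eq_zero measurableSet_Ioc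
      (Ioc_subset_Ioc_right ht.2) fun s hs => ?_).symm
  · simp only [causal_of_nonneg (sub_nonneg.2 hs.2)]
  · have hts : t < s := not_le.1 fun hst => hs.2 ⟨hs.1.1, hst⟩
    rw [causal_of_neg (sub_neg.2 hts), zero_apply]

theorem norm_integral_apply_le {T C m : ℝ} (hC : ∀ t ∈ Icc 0 T, ‖S t‖ ≤ C)
    {k : ℝ → X} (hk : ∀ s ∈ Ioc 0 T, ‖k s‖ ≤ m) {a t : ℝ} (ha : 0 ≤ a) (hat : a ≤ t)
    (htT : t ≤ T) : ‖∫ s in a..t, S (t - s) (k s)‖ ≤ C * m * (t - a) := by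
  rw [← abs_of_nonneg (sub_nonneg.2 hat)]
  refine intervalIntegral.norm_integral_le_of_norm_le_const fun s hs => ?_
  rw [uIoc_of_le hat] at hs
  exact (S _).le_of_opNorm_le_of_le (hC _ ⟨by linarith [hs.2], by linarith [hs.1]⟩)
    (hk s ⟨by linarith [hs.1], by linarith [hs.2]⟩)

theorem norm_conv_le {T C m : ℝ} (hC : ∀ t ∈ Icc 0 T, ‖S t‖ ≤ C) {k : ℝ → X}
    (hk : ∀ s ∈ Ioc 0 T, ‖k s‖ ≤ m) {t : ℝ} (ht : t ∈ Icc 0 T) :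
    ‖S.conv k t‖ ≤ C * m * t := by
  simpa [conv] using norm_integral_apply_le hC hk le_rfl ht.1 ht.2

variable [CompleteSpace X]

theorem conv_add {T : ℝ} {k l : ℝ → X} (hk : IntegrableOn k (Icc 0 T))
    (hl : IntegrableOn l (Icc 0 T)) {t : ℝ} (ht : t ∈ Icc 0 T) :
    S.conv (k + l) t = S.conv k t + S.conv l t := by
  simp only [conv, Pi.add_apply, _root_.map_add]
  exact intervalIntegral.integral_add (intervalIntegrable_apply hk le_rfl ht.1 le_rfl ht.2)
    (intervalIntegrable_apply hl le_rfl ht.1 le_rfl ht.2)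

theorem conv_add_time {T : ℝ} {k : ℝ → X} (hk : IntegrableOn k (Icc 0 T)) {s t : ℝ} (hs : 0 ≤ s)
    (hst : s ≤ t) (htT : t ≤ T) :
    S.conv k t = S (t - s) (S.conv k s) + ∫ r in s..t, S (t - r) (k r) := by
  rw [conv, ← intervalIntegral.integral_add_adjacent_intervals
    (intervalIntegrable_apply hk le_rfl hs hst htT) (intervalIntegrable_apply hk hs hst le_rfl htT),
    conv, ← ContinuousLinearMap.intervalIntegral_comp_comm _
      (intervalIntegrable_apply hk le_rfl hs le_rfl (hst.trans htT))]
  congr 1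
  refine intervalIntegral.integral_congr fun r hr => ?_
  rw [uIcc_of_le hs] at hr
  rw [← sub_add_sub_cancel t s r, S.map_add _ _ (sub_nonneg.2 hst) (sub_nonneg.2 hr.2)]
  rfl

theorem continuousOn_conv {T : ℝ} {k : ℝ → X} (hk : IntegrableOn k (Icc 0 T)) :
    ContinuousOn (S.conv k) (Icc 0 T) := by
  obtain ⟨C, hC0, hC⟩ := S.exists_forall_norm_le T
  refine ContinuousOn.congr (fun t₀ _ => ?_) fun t ht => conv_eq_setIntegral_causal k ht
  have hk' : IntegrableOn k (Ioc 0 T) := hk.mono_set Ioc_subset_Icc_self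
  refine continuousWithinAt_of_dominated (bound := fun s => C * ‖k s‖) ?_ ?_
    (hk'.norm.const_mul C) ?_
  · exact .of_forall fun t => aestronglyMeasurable_causal_apply (by fun_prop) hk'.1
  · filter_upwards [self_mem_nhdsWithin] with t ht
    exact ae_restrict_of_forall_mem measurableSet_Ioc fun s hs =>
      norm_causal_apply_le hC hC0 (by linarith [hs.1, ht.2]) _
  · have hne : ∀ᵐ s ∂(volume.restrict (Ioc 0 T)), s ≠ t₀ :=
      ae_restrict_of_ae (by simp [ae_iff, measure_singleton])
    filter_upwards [hne] with s hs
    exact (ContinuousAt.comp (f := fun t => t - s) (continuousAt_causal_apply (k s)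
      (sub_ne_zero.2 hs.symm)) (by fun_prop)).continuousWithinAt

variable (S) in
/-- The convolution with an integrable function as an element of the trajectory space
`C([0, T], X)`. -/
noncomputable def convOn {T : ℝ} {k : ℝ → X} (hk : IntegrableOn k (Icc 0 T)) :
    C(Icc (0 : ℝ) T, X) :=
  ⟨fun t => S.conv k t, (continuousOn_conv hk).domRestrict⟩

theorem convOn_add {T : ℝ} {k l : ℝ → X} (hk : IntegrableOn k (Icc 0 T) volume)
    (hl : IntegrableOn l (Icc 0 T) volume) : S.convOn (hk.add hl) = S.convOn hk + S.convOn hl :=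
  ContinuousMap.ext fun t => conv_add hk hl t.2

theorem convOn_smul {T : ℝ} (c : 𝕜) {k : ℝ → X} (hk : IntegrableOn k (Icc 0 T) volume) :
    S.convOn (k := c • k) (hk.smul c) = c • S.convOn hk :=
  ContinuousMap.ext fun t => conv_smul c k t

theorem convOn_sub {T : ℝ} {k l : ℝ → X} (hk : IntegrableOn k (Icc 0 T) volume)
    (hl : IntegrableOn l (Icc 0 T) volume) :
    S.convOn (k := k - l) (hk.sub hl) = S.convOn hk - S.convOn hl := by
  rw [eq_sub_iff_add_eq, ← convOn_add]
  simp only [sub_add_cancel]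

theorem exists_forall_norm_convOn_sub_le (S : C0Semigroup 𝕜 X) (T : ℝ) :
    ∃ C, 0 ≤ C ∧ ∀ {k l : ℝ → X} (hk : IntegrableOn k (Icc 0 T) volume)
      (hl : IntegrableOn l (Icc 0 T) volume) {m : ℝ}, 0 ≤ m →
        (∀ s ∈ Ioc 0 T, ‖k s - l s‖ ≤ m) → ‖S.convOn hk - S.convOn hl‖ ≤ C * m := by
  obtain ⟨C, hC0, hC⟩ := S.exists_forall_norm_le T
  refine ⟨C * |T|, by positivity, fun {k l} hk hl m hm hkl => ?_⟩
  rw [← convOn_sub]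
  refine (ContinuousMap.norm_le _ (by positivity)).2 fun t => (norm_conv_le hC hkl t.2).trans ?_
  rw [mul_right_comm]
  gcongr
  exact t.2.2.trans (le_abs_self T)

end Convolution

section Compactness

variable [NormedSpace ℝ X] [CompleteSpace X] {S : C0Semigroup 𝕜 X}

theorem totallyBounded_conv (hS : S.IsCompact) (T : ℝ) {m : ℝ} (hm : 0 ≤ m) :
    TotallyBounded {x : X | ∃ k : ℝ → X, IntegrableOn k (Icc 0 T) ∧ (∀ s ∈ Ioc 0 T, ‖k s‖ ≤ m) ∧
      ∃ t ∈ Icc 0 T, S.conv k t = x} := by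
  obtain ⟨C, hC0, hC⟩ := S.exists_forall_norm_le T
  refine Metric.totallyBounded_iff.2 fun ε hε => ?_
  obtain ⟨δ, hδ, hδε⟩ : ∃ δ > 0, C * m * δ < ε / 2 :=
    exists_pos_mul_lt (half_pos hε) _
  have hball : TotallyBounded (S δ '' Metric.closedBall 0 (C * m * |T|)) :=
    ((hS δ hδ).isCompact_closure_image_closedBall _).totallyBounded.subset subset_closure
  obtain ⟨N, hN, hcover⟩ := Metric.totallyBounded_iff.1 hball (ε / 2) (half_pos hε)
  refine ⟨N, hN, ?_⟩
  rintro x ⟨k, hk, hkm, t, ht, rfl⟩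
  obtain ⟨p, hp, hdist⟩ : ∃ p ∈ S δ '' Metric.closedBall 0 (C * m * |T|),
      dist (S.conv k t) p < ε / 2 := by
    rcases le_total δ t with h | h
    · refine ⟨S δ (S.conv k (t - δ)), ⟨_, ?_, rfl⟩, ?_⟩
      · rw [mem_closedBall_zero_iff]
        refine (norm_conv_le hC hkm ⟨sub_nonneg.2 h, by linarith [ht.2]⟩).trans ?_
        gcongr
        linarith [ht.2, le_abs_self T]
      · have hsplit := conv_add_time (S := S) hk (sub_nonneg.2 h) (sub_le_self t hδ.le) ht.2
        rw [sub_sub_cancel] at hsplit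
        rw [hsplit, dist_eq_norm, add_sub_cancel_left]
        refine (norm_integral_apply_le hC hkm (sub_nonneg.2 h) (by linarith) ht.2).trans_lt ?_
        rwa [sub_sub_cancel]
    · refine ⟨S δ 0, ⟨0, Metric.mem_closedBall_self (by positivity), rfl⟩, ?_⟩
      rw [_root_.map_zero, dist_zero_right]
      exact ((norm_conv_le hC hkm ht).trans (by gcongr)).trans_lt hδε
  obtain ⟨y, hy, hpy⟩ := mem_iUnion₂.1 (hcover hp)
  refine mem_iUnion₂.2 ⟨y, hy, (dist_triangle _ p y).trans_lt ?_⟩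
  linarith [Metric.mem_ball.1 hpy]

theorem exists_forall_norm_conv_sub_lt (hS : S.IsCompact) (T : ℝ) {m : ℝ} (hm : 0 ≤ m) {ε : ℝ}
    (hε : 0 < ε) : ∃ δ > 0, ∀ k : ℝ → X, IntegrableOn k (Icc 0 T) → (∀ r ∈ Ioc 0 T, ‖k r‖ ≤ m) →
      ∀ s t, 0 ≤ s → s ≤ t → t ≤ T → t - s < δ → ‖S.conv k t - S.conv k s‖ < ε := by
  obtain ⟨C, hC0, hC⟩ := S.exists_forall_norm_le T
  obtain ⟨δ₁, hδ₁, hunif⟩ := S.exists_forall_norm_apply_sub_lt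
    ((totallyBounded_conv hS T hm).closure.isCompact_of_isClosed isClosed_closure) (half_pos hε)
  obtain ⟨δ₂, hδ₂, hCδ₂⟩ : ∃ δ > 0, C * m * δ < ε / 2 := exists_pos_mul_lt (half_pos hε) _
  refine ⟨min δ₁ δ₂, lt_min hδ₁ hδ₂, fun k hk hkm s t hs hst htT hδ => ?_⟩
  have hpast : ‖S (t - s) (S.conv k s) - S.conv k s‖ < ε / 2 :=
    hunif _ (sub_nonneg.2 hst) (hδ.trans_le (min_le_left _ _)) _
      (subset_closure ⟨k, hk, hkm, s, ⟨hs, hst.trans htT⟩, rfl⟩)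
  have hrecent : ‖∫ r in s..t, S (t - r) (k r)‖ < ε / 2 :=
    calc ‖∫ r in s..t, S (t - r) (k r)‖ ≤ C * m * (t - s) :=
          norm_integral_apply_le hC hkm hs hst htT
      _ ≤ C * m * δ₂ := by gcongr; exact hδ.le.trans (min_le_right _ _)
      _ < ε / 2 := hCδ₂
  rw [conv_add_time hk hs hst htT, add_sub_right_comm]
  exact (norm_add_le _ _).trans_lt (by linarith)

theorem isCompact_closure_convOn (hS : S.IsCompact) (T : ℝ) {m : ℝ} (hm : 0 ≤ m) :
    _root_.IsCompact (closure {y : C(Icc (0 : ℝ) T, X) | ∃ (k : ℝ → X)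
      (hk : IntegrableOn k (Icc 0 T) volume), (∀ s ∈ Ioc 0 T, ‖k s‖ ≤ m) ∧ S.convOn hk = y}) := by
  refine isCompact_closure_of_equicontinuous
    ((totallyBounded_conv hS T hm).closure.isCompact_of_isClosed isClosed_closure) ?_ fun t => ?_
  · rintro _ ⟨k, hk, hkm, rfl⟩ t
    exact subset_closure ⟨k, hk, hkm, t, t.2, rfl⟩
  · refine Metric.equicontinuousAt_iff.2 fun ε hε => ?_
    obtain ⟨δ, hδ, hconv⟩ := exists_forall_norm_conv_sub_lt hS T hm hε
    refine ⟨δ, hδ, ?_⟩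
    rintro s hs ⟨_, k, hk, hkm, rfl⟩
    rw [Subtype.dist_eq, Real.dist_eq] at hs
    rcases le_total s t with hst | hst
    · rw [dist_eq_norm]
      exact hconv k hk hkm s t s.2.1 hst t.2.2 (by linarith [neg_abs_le ((s : ℝ) - t)])
    · rw [dist_comm, dist_eq_norm]
      exact hconv k hk hkm t s t.2.1 hst s.2.2 (by linarith [le_abs_self ((s : ℝ) - t)])

end Compactness

end C0Semigroup

/-! ### Approximation by trajectories of the control system -/

theorem exists_clm_ne_zero_of_notMem_closure {𝕜 E : Type*} [RCLike 𝕜] [NormedAddCommGroup E]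
    [NormedSpace 𝕜 E] {V : Submodule 𝕜 E} {x : E} (hx : x ∉ closure (V : Set E)) :
    ∃ q : E →L[𝕜] 𝕜, q x ≠ 0 ∧ ∀ y ∈ V, q y = 0 := by
  have : IsClosed (V.topologicalClosure : Set E) := V.isClosed_topologicalClosure
  obtain ⟨q, hq⟩ := SeparatingDual.exists_ne_zero (R := 𝕜)
    (mt (Submodule.Quotient.mk_eq_zero V.topologicalClosure).1 hx)
  refine ⟨q ∘L V.topologicalClosure.mkQL, hq, fun y hy => ?_⟩
  have hy0 : V.topologicalClosure.mkQ y = 0 :=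
    (Submodule.Quotient.mk_eq_zero _).2 (V.le_topologicalClosure hy)
  exact (congrArg q hy0).trans q.map_zero

namespace C0Semigroup

variable {𝕜 X : Type*} [RCLike 𝕜] [NormedAddCommGroup X] [InnerProductSpace 𝕜 X]

section Orbit

variable [CompleteSpace X] (S : C0Semigroup 𝕜 X)

/-- The orbit map `x ↦ (t ↦ S t x)` into the trajectory space `C([0, T], X)`. -/
noncomputable def orbitOn (T : ℝ) : X →L[𝕜] C(Icc (0 : ℝ) T, X) :=
  LinearMap.mkContinuousOfExistsBound
    { toFun := fun x => ⟨fun t => S t x,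
        ((S.strong_continuity x).mono Icc_subset_Ici_self).domRestrict⟩
      map_add' := fun x y => ContinuousMap.ext fun t => (S t).map_add x y
      map_smul' := fun c x => ContinuousMap.ext fun t => (S t).map_smul c x }
    (by
      obtain ⟨C, hC0, hC⟩ := S.exists_forall_norm_le T
      exact ⟨C, fun x => (ContinuousMap.norm_le _ (by positivity)).2 fun t =>
        (S t).le_of_opNorm_le (hC t t.2) x⟩)

theorem orbitOn_apply {T : ℝ} (x : X) (t : Icc (0 : ℝ) T) : S.orbitOn T x t = S t x := rfl

end Orbit

section Primitive

variable [NormedSpace ℝ X] (S : C0Semigroup 𝕜 X)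

/-- The primitive `t ↦ ∫₀ᵗ S r w dr` of an orbit. It takes values in the domain of the generator,
which maps it to `S t w - w`. -/
noncomputable def primitive (w : X) (t : ℝ) : X := ∫ r in (0 : ℝ)..t, S r w

variable {S}

theorem conv_const (w : X) (t : ℝ) : S.conv (fun _ => w) t = S.primitive w t := by
  have hsubst := intervalIntegral.integral_comp_sub_left (a := 0) (b := t) (fun r => S r w) t
  rwa [sub_self, sub_zero] at hsubst

theorem primitive_eq_setIntegral_causal (w : X) {s T : ℝ} (hs : s ∈ Icc 0 T) :
    S.primitive w (T - s) = ∫ r in Ioc 0 T, S.causal (r - s) w := by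
  have hT : 0 ≤ T := hs.1.trans hs.2
  rw [← conv_const, conv_eq_setIntegral_causal _ ⟨sub_nonneg.2 hs.2, sub_le_self T hs.1⟩,
    ← intervalIntegral.integral_of_le hT, ← intervalIntegral.integral_of_le hT]
  have hsubst := intervalIntegral.integral_comp_sub_left (a := 0) (b := T)
    (fun r => S.causal (r - s) w) T
  rw [sub_self, sub_zero] at hsubst
  rw [← hsubst]
  simp only [sub_right_comm]

variable [CompleteSpace X]

theorem primitive_add (w : X) {s t : ℝ} (hs : 0 ≤ s) (ht : 0 ≤ t) :
    S.primitive w (s + t) = S s (S.primitive w t) + S.primitive w s := by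
  have hsplit := conv_add_time (S := S) (k := fun _ => w) (T := s + t)
    (integrableOn_const (by simp)) ht (by linarith) le_rfl
  rw [intervalIntegral.integral_comp_sub_left (fun r => S r w) (s + t)] at hsplit
  simpa [conv_const, primitive] using hsplit

theorem primitive_apply (w : X) {s t : ℝ} (hs : 0 ≤ s) (ht : 0 ≤ t) :
    S.primitive (S t w) s = S t (S.primitive w s) := by
  have hint : IntervalIntegrable (fun r => S r w) volume 0 s :=
    ((S.strong_continuity w).mono Icc_subset_Ici_self).intervalIntegrable_of_Icc hs
  rw [primitive, primitive, ← ContinuousLinearMap.intervalIntegral_comp_comm _ hint]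
  refine intervalIntegral.integral_congr fun r hr => ?_
  rw [uIcc_of_le hs] at hr
  calc S r (S t w) = S (r + t) w := by rw [S.map_add _ _ hr.1 ht]; rfl
    _ = S t (S r w) := by rw [add_comm, S.map_add _ _ ht hr.1]; rfl

theorem primitive_apply_eq_add (w : X) {s t : ℝ} (hs : 0 ≤ s) (ht : 0 ≤ t) :
    S.primitive (S t w) s =
      S.primitive w s + (S s (S.primitive w t) - S.primitive w t) := by
  have hcomm := primitive_add (S := S) w ht hs
  rw [add_comm t s, primitive_add w hs ht] at hcomm
  rw [primitive_apply w hs ht, ← add_sub_assoc, eq_sub_iff_add_eq, ← hcomm, add_comm]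

variable (S) in
/-- The operator sending `w` to the primitive of its orbit, as an element of `C([0, T], X)`. -/
noncomputable def primitiveOn (T : ℝ) : X →L[𝕜] C(Icc (0 : ℝ) T, X) :=
  LinearMap.mkContinuousOfExistsBound
    { toFun := fun w => S.convOn (k := fun _ => w) (integrableOn_const (by simp))
      map_add' := fun _ _ => convOn_add _ _
      map_smul' := fun c _ => convOn_smul c _ }
    (by
      obtain ⟨C, -, hC⟩ := S.exists_forall_norm_convOn_sub_le T
      refine ⟨C, fun w => ?_⟩
      have h := hC (k := fun _ => w) (l := 0) (integrableOn_const (by simp)) integrableOn_zero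
        (norm_nonneg w) fun _ _ => by simp
      have hzero : S.convOn (T := T) (k := 0) integrableOn_zero = 0 := by
        ext t
        simp [convOn, conv]
      rwa [hzero, sub_zero] at h)

theorem primitiveOn_apply {T : ℝ} (w : X) (t : Icc (0 : ℝ) T) :
    S.primitiveOn T w t = S.primitive w t := conv_const w t

end Primitive

section Fubini

variable [CompleteSpace X] {S : C0Semigroup 𝕜 X} {T : ℝ} {k : ℝ → X}

theorem integrable_causal_prod (hk : IntegrableOn k (Icc 0 T)) :
    Integrable (fun p : ℝ × ℝ => S.causal (p.2 - p.1) (k p.1))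
      ((volume.restrict (Ioc 0 T)).prod (volume.restrict (Ioc 0 T))) := by
  obtain ⟨C, hC0, hC⟩ := S.exists_forall_norm_le T
  have hk' : IntegrableOn k (Ioc 0 T) := hk.mono_set Ioc_subset_Icc_self
  refine ((hk'.norm.const_mul C).comp_fst (volume.restrict (Ioc 0 T))).mono'
    (aestronglyMeasurable_causal_apply (by fun_prop) hk'.1.comp_fst) ?_
  rw [Measure.prod_restrict]
  exact ae_restrict_of_forall_mem (measurableSet_Ioc.prod measurableSet_Ioc) fun p hp =>
    norm_causal_apply_le hC hC0 (by linarith [hp.1.1, hp.2.2]) _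

variable [NormedSpace ℝ X]

theorem intervalIntegrable_primitive (hk : IntegrableOn k (Icc 0 T)) (hT : 0 ≤ T) :
    IntervalIntegrable (fun s => S.primitive (k s) (T - s)) volume 0 T := by
  rw [intervalIntegrable_iff_integrableOn_Ioc_of_le hT]
  refine IntegrableOn.congr_fun (integrable_causal_prod (S := S) hk).integral_prod_left
    (fun s hs => ?_) measurableSet_Ioc
  exact (primitive_eq_setIntegral_causal (k s) (Ioc_subset_Icc_self hs)).symm

theorem integral_primitive (hk : IntegrableOn k (Icc 0 T)) (hT : 0 ≤ T) :
    ∫ s in (0 : ℝ)..T, S.primitive (k s) (T - s) = ∫ r in (0 : ℝ)..T, S.conv k r := by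
  rw [intervalIntegral.integral_of_le hT, intervalIntegral.integral_of_le hT]
  calc ∫ s in Ioc 0 T, S.primitive (k s) (T - s)
      = ∫ s in Ioc 0 T, ∫ r in Ioc 0 T, S.causal (r - s) (k s) :=
        setIntegral_congr_fun measurableSet_Ioc fun s hs =>
          primitive_eq_setIntegral_causal (k s) (Ioc_subset_Icc_self hs)
    _ = ∫ r in Ioc 0 T, ∫ s in Ioc 0 T, S.causal (r - s) (k s) :=
        integral_integral_swap (integrable_causal_prod hk)
    _ = ∫ r in Ioc 0 T, S.conv k r :=
        setIntegral_congr_fun measurableSet_Ioc fun r hr =>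
          (conv_eq_setIntegral_causal k (Ioc_subset_Icc_self hr)).symm

end Fubini

section AdjointGenerator

variable [NormedSpace ℝ X] (S : C0Semigroup 𝕜 X)

/-- The functional `P` lies in the domain of the adjoint `A*` of the generator and `A* P = a`. The
relation is stated in integrated form along orbits, so that `A` itself is not involved. -/
def HasAdjointGenerator (P a : X →L[𝕜] 𝕜) : Prop :=
  ∀ x t, 0 ≤ t → P (S t x) = P x + a (S.primitive x t)

variable [CompleteSpace X]

theorem hasAdjointGenerator_comp_primitiveOn {T : ℝ} (q : C(Icc (0 : ℝ) T, X) →L[𝕜] 𝕜) :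
    S.HasAdjointGenerator (q ∘L S.primitiveOn T)
      (q ∘L (S.orbitOn T - ContinuousLinearMap.const 𝕜 (Icc (0 : ℝ) T))) := by
  intro x t ht
  simp only [ContinuousLinearMap.comp_apply]
  rw [← _root_.map_add]
  congr 1
  ext s
  simpa [primitiveOn_apply, orbitOn_apply] using primitive_apply_eq_add x s.2.1 ht

variable {S} {P a : X →L[𝕜] 𝕜}

theorem HasAdjointGenerator.apply_conv (hP : S.HasAdjointGenerator P a) {T : ℝ} (hT : 0 ≤ T)
    {k : ℝ → X} (hk : IntegrableOn k (Icc 0 T)) :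
    P (S.conv k T) = ∫ s in (0 : ℝ)..T, (P (k s) + a (S.conv k s)) := by
  have hSk : IntervalIntegrable (fun s => S (T - s) (k s)) volume 0 T :=
    intervalIntegrable_apply hk le_rfl hT le_rfl le_rfl
  have hPk : IntervalIntegrable (fun s => P (k s)) volume 0 T :=
    (intervalIntegrable_iff_integrableOn_Ioc_of_le hT).2
      (P.integrable_comp (hk.mono_set Ioc_subset_Icc_self))
  have hconv : IntervalIntegrable (S.conv k) volume 0 T :=
    (continuousOn_conv hk).intervalIntegrable_of_Icc hT
  have hprim := intervalIntegrable_primitive (S := S) hk hT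
  calc P (S.conv k T) = ∫ s in (0 : ℝ)..T, P (S (T - s) (k s)) :=
        (P.intervalIntegral_comp_comm hSk).symm
    _ = ∫ s in (0 : ℝ)..T, (P (k s) + a (S.primitive (k s) (T - s))) := by
        refine intervalIntegral.integral_congr fun s hs => ?_
        rw [uIcc_of_le hT] at hs
        exact hP _ _ (sub_nonneg.2 hs.2)
    _ = (∫ s in (0 : ℝ)..T, P (k s)) + a (∫ r in (0 : ℝ)..T, S.conv k r) := by
        rw [intervalIntegral.integral_add hPk
            ⟨a.integrable_comp hprim.1, a.integrable_comp hprim.2⟩,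
          a.intervalIntegral_comp_comm hprim, integral_primitive hk hT]
    _ = ∫ s in (0 : ℝ)..T, (P (k s) + a (S.conv k s)) := by
        rw [← a.intervalIntegral_comp_comm hconv, intervalIntegral.integral_add hPk
          ⟨a.integrable_comp hconv.1, a.integrable_comp hconv.2⟩]

end AdjointGenerator

section Control

variable {U : Type*} [NormedAddCommGroup U] [InnerProductSpace 𝕜 U]

theorem integrableOn_control (B : U →L[𝕜] X) {T : ℝ} {u : ℝ → U}
    (hu : MemLp u 2 (volume.restrict (Icc 0 T))) : IntegrableOn (fun s => B (u s)) (Icc 0 T) :=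
  B.integrable_comp (hu.integrable one_le_two)

variable [NormedSpace ℝ X] [CompleteSpace X] {S : C0Semigroup 𝕜 X} {B : U →L[𝕜] X} {T : ℝ}

theorem HasAdjointGenerator.apply_eq_zero {P a : X →L[𝕜] 𝕜} (hP : S.HasAdjointGenerator P a)
    (hPB : ∀ u, P (B u) = 0) (hT : 0 ≤ T) {v : X} (hv : P v = 1) {u : ℝ → U} {y : ℝ → X}
    (hu : MemLp u 2 (volume.restrict (Icc 0 T)))
    (hy : IsMildSolution S B (fun _ z => -(a z • v)) T 0 u y) : P (y T) = 0 := by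
  let k : ℝ → X := fun s => B (u s) + -(a (y s) • v)
  have hk : IntegrableOn k (Icc 0 T) := (integrableOn_control B hu).add
    (((a.continuous.comp_continuousOn hy.1).smul continuousOn_const).neg.integrableOn_compact
      isCompact_Icc)
  have hconv : ∀ t ∈ Icc 0 T, y t = S.conv k t := fun t ht => by
    rw [hy.2 t ht, _root_.map_zero, zero_add, conv]
  rw [hconv T ⟨hT, le_rfl⟩, hP.apply_conv hT hk]
  refine (intervalIntegral.integral_congr fun s hs => ?_).trans intervalIntegral.integral_zero
  rw [uIcc_of_le hT] at hs
  simp [k, ← hconv s hs, hPB, hv]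

-- The feedback `-(a ⊗ v)` with `P v = 1` makes `P` constant along every trajectory.
theorem HasAdjointGenerator.eq_zero {P a : X →L[𝕜] 𝕜} (hP : S.HasAdjointGenerator P a)
    (hPB : ∀ u, P (B u) = 0) (hT : 0 ≤ T)
    (hAC : ∀ G : X →L[𝕜] X, ApproximatelyControllable S B (fun _ y => G y) T) : P = 0 := by
  by_contra hne
  obtain ⟨x, hx⟩ := DFunLike.ne_iff.1 hne
  let v : X := (P x)⁻¹ • x
  have hv : P v = 1 := by simpa [v] using inv_mul_cancel₀ hx
  obtain ⟨u, y, hu, hy, -, hyv⟩ := hAC (-(a.smulRight v)) 0 v (1 / (‖P‖ + 1)) (by positivity)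
  have hPy : P (y T) = 0 := hP.apply_eq_zero hPB hT hv hu hy
  have hle : 1 ≤ ‖P‖ * ‖y T - v‖ := by simpa [hPy, hv] using P.le_opNorm (y T - v)
  rw [lt_div_iff₀ (by positivity)] at hyv
  linarith [norm_nonneg (y T - v)]

theorem primitiveOn_mem_closure (hT : 0 ≤ T)
    (hAC : ∀ G : X →L[𝕜] X, ApproximatelyControllable S B (fun _ y => G y) T) (x : X) :
    S.primitiveOn T x ∈ closure (range fun u => S.primitiveOn T (B u)) := by
  let V : Submodule 𝕜 C(Icc (0 : ℝ) T, X) := LinearMap.range (S.primitiveOn T ∘L B : U →ₗ[𝕜] _)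
  by_contra hx
  obtain ⟨q, hqx, hqV⟩ := exists_clm_ne_zero_of_notMem_closure (V := V) hx
  exact hqx (DFunLike.congr_fun ((S.hasAdjointGenerator_comp_primitiveOn q).eq_zero
    (fun u => hqV _ ⟨u, rfl⟩) hT hAC) x)

end Control

end C0Semigroup

theorem exists_mem_forall_norm_sub_le_of_uniformContinuous {𝕜 E : Type*} [Semiring 𝕜]
    [NormedAddCommGroup E] [Module 𝕜 E] {V : Submodule 𝕜 (ℝ → E)}
    (hV : ∀ a b x, 0 ≤ a → a ≤ b → ((Ioc a b).indicator fun _ => x) ∈ V) {h : ℝ → E}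
    (hh : UniformContinuous h) (T : ℝ) {ε : ℝ} (hε : 0 < ε) :
    ∃ g ∈ V, ∀ s ∈ Ioc 0 T, ‖g s - h s‖ ≤ ε := by
  obtain ⟨δ, hδ, hhδ⟩ := Metric.uniformContinuous_iff.1 hh ε hε
  let τ : ℝ := δ / 2
  have hτ : 0 < τ := half_pos hδ
  have hτδ : τ < δ := half_lt_self hδ
  have hstep : ∀ n : ℕ, ∃ g ∈ V, (∀ s ∈ Ioc 0 (n * τ), ‖g s - h s‖ ≤ ε) ∧
      ∀ s, n * τ < s → g s = 0 := by
    intro n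
    induction n with
    | zero => exact ⟨0, V.zero_mem, by simp, fun _ _ => rfl⟩
    | succ n ih =>
      obtain ⟨g, hg, hgh, hg0⟩ := ih
      refine ⟨g + (Ioc (n * τ) ((n + 1 : ℕ) * τ)).indicator fun _ => h (n * τ),
        V.add_mem hg (hV _ _ _ (by positivity) (by gcongr; simp)), fun s hs => ?_, fun s hs => ?_⟩
      · rcases le_or_gt s (n * τ) with hsn | hsn
        · simpa [hsn.not_gt] using hgh s ⟨hs.1, hsn⟩
        · have hmem : s ∈ Ioc (n * τ) ((n + 1 : ℕ) * τ) := ⟨hsn, hs.2⟩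
          rw [Pi.add_apply, indicator_of_mem hmem, hg0 s hsn, zero_add, ← dist_eq_norm']
          refine (hhδ ?_).le
          have hsn' : s ≤ n * τ + τ := by simpa [add_one_mul] using hs.2
          rw [Real.dist_eq, abs_of_pos (sub_pos.2 hsn)]
          linarith
      · have hns : n * τ ≤ (n + 1 : ℕ) * τ := by gcongr; simp
        rw [Pi.add_apply, hg0 s (hns.trans_lt hs), zero_add]
        exact indicator_of_notMem (fun hmem => hs.not_ge hmem.2) _
  obtain ⟨n, hn⟩ := Archimedean.arch T hτ
  obtain ⟨g, hg, hgh, -⟩ := hstep n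
  exact ⟨g, hg, fun s hs => hgh s ⟨hs.1, hs.2.trans (by simpa using hn)⟩⟩

theorem integrableOn_IccExtend {E : Type*} [NormedAddCommGroup E] {a b : ℝ} (hab : a ≤ b)
    (k : C(Icc a b, E)) : IntegrableOn (IccExtend hab k) (Icc a b) volume :=
  k.continuous.Icc_extend'.continuousOn.integrableOn_compact isCompact_Icc

namespace C0Semigroup

section Tracking

variable {𝕜 X U : Type*} [RCLike 𝕜] [NormedAddCommGroup X] [InnerProductSpace 𝕜 X]
  [NormedSpace ℝ X] [NormedAddCommGroup U] [InnerProductSpace 𝕜 U]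
  (S : C0Semigroup 𝕜 X) (B : U →L[𝕜] X) (T : ℝ)

variable {S} in
theorem conv_indicator_Ioi (w : X) {a t : ℝ} (ha : 0 ≤ a) (ht : 0 ≤ t) :
    S.conv ((Ioi a).indicator fun _ => w) t = S.primitive w (max (t - a) 0) := by
  have hcomp : (fun s => S (t - s) ((Ioi a).indicator (fun _ => w) s)) =
      (Ioi a).indicator fun s => S (t - s) w := by
    ext s
    by_cases hs : s ∈ Ioi a <;> simp [hs]
  have hset : Ioc 0 t ∩ Ioi a = Ioc a t := by
    rw [Ioc_inter_Ioi, max_eq_right ha]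
  rw [conv, hcomp, intervalIntegral.integral_of_le ht, setIntegral_indicator measurableSet_Ioi,
    hset]
  rcases le_total a t with h | h
  · rw [max_eq_left (sub_nonneg.2 h), ← intervalIntegral.integral_of_le h,
      intervalIntegral.integral_comp_sub_left (fun r => S r w) t, sub_self, primitive]
  · rw [max_eq_right (sub_nonpos.2 h), Ioc_eq_empty h.not_gt, setIntegral_empty, primitive,
      intervalIntegral.integral_same]

variable [CompleteSpace X]

/-- The trajectories on `[0, T]` of `y' = A y + B u`, `y(0) = 0`, for square-integrable `u`. -/
def reachable : Submodule 𝕜 C(Icc (0 : ℝ) T, X) where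
  carrier := {y | ∃ u : ℝ → U, MemLp u 2 (volume.restrict (Icc 0 T)) ∧
    ∀ t, y t = S.conv (fun s => B (u s)) t}
  zero_mem' := ⟨0, MemLp.zero, fun t => by simp [conv]⟩
  add_mem' := by
    rintro y z ⟨u, hu, hy⟩ ⟨v, hv, hz⟩
    refine ⟨u + v, hu.add hv, fun t => ?_⟩
    rw [ContinuousMap.add_apply, hy, hz,
      ← conv_add (integrableOn_control B hu) (integrableOn_control B hv) t.2]
    congr 1
    ext s
    exact ((B.map_add (u s) (v s))).symm
  smul_mem' := by
    rintro c y ⟨u, hu, hy⟩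
    refine ⟨c • u, hu.const_smul c, fun t => ?_⟩
    rw [ContinuousMap.smul_apply, hy, ← conv_smul]
    congr 1
    ext s
    exact (B.map_smul c (u s)).symm

/-- The forcing terms `k` whose response `S.conv k` is a uniform limit of trajectories driven by
controls. -/
def trackable : Submodule 𝕜 (ℝ → X) where
  carrier := {k | ∃ hk : IntegrableOn k (Icc 0 T) volume,
    S.convOn hk ∈ (S.reachable B T).topologicalClosure}
  zero_mem' := by
    refine ⟨integrableOn_zero, ?_⟩
    convert Submodule.zero_mem _
    ext t
    simp [convOn, conv]
  add_mem' := by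
    rintro k l ⟨hk, hk'⟩ ⟨hl, hl'⟩
    refine ⟨hk.add hl, ?_⟩
    rw [convOn_add hk hl]
    exact Submodule.add_mem _ hk' hl'
  smul_mem' := by
    rintro c k ⟨hk, hk'⟩
    refine ⟨hk.smul c, ?_⟩
    rw [convOn_smul (S := S) c hk]
    exact Submodule.smul_mem _ c hk'

variable {S B T}

theorem mem_trackable_of_forall_exists_norm_sub_le {k : ℝ → X}
    (hk : IntegrableOn k (Icc 0 T) volume)
    (happ : ∀ ε > 0, ∃ l ∈ S.trackable B T, ∀ s ∈ Ioc 0 T, ‖l s - k s‖ ≤ ε) :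
    k ∈ S.trackable B T := by
  obtain ⟨C, -, hC⟩ := S.exists_forall_norm_convOn_sub_le T
  refine ⟨hk, ?_⟩
  rw [← SetLike.mem_coe, ← (S.reachable B T).isClosed_topologicalClosure.closure_eq]
  refine Metric.mem_closure_iff.2 fun ε hε => ?_
  obtain ⟨δ, hδ, hCδ⟩ : ∃ δ > 0, C * δ < ε := exists_pos_mul_lt hε C
  obtain ⟨l, ⟨hl, hlr⟩, hlk⟩ := happ δ hδ
  refine ⟨S.convOn hl, hlr, ?_⟩
  rw [dist_comm, dist_eq_norm]
  exact (hC hl hk hδ.le hlk).trans_lt hCδ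

theorem indicator_Ioi_mem_trackable (hT : 0 ≤ T)
    (hAC : ∀ G : X →L[𝕜] X, ApproximatelyControllable S B (fun _ y => G y) T) {a : ℝ}
    (ha : 0 ≤ a) (x : X) : ((Ioi a).indicator fun _ => x) ∈ S.trackable B T := by
  have hint : ∀ w : X, IntegrableOn ((Ioi a).indicator fun _ => w) (Icc 0 T) volume := fun w =>
    Integrable.indicator (integrableOn_const (by simp)) measurableSet_Ioi
  let delay : C(Icc (0 : ℝ) T, Icc (0 : ℝ) T) :=
    ⟨fun t => ⟨max (t - a) 0, le_max_right _ _, max_le (by linarith [t.2.2]) hT⟩, by fun_prop⟩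
  have hdelay : ∀ w, S.convOn (hint w) = (S.primitiveOn T w).comp delay := fun w =>
    ContinuousMap.ext fun t =>
      (conv_indicator_Ioi w ha t.2.1).trans (primitiveOn_apply w (delay t)).symm
  refine ⟨hint x, ?_⟩
  rw [hdelay]
  refine map_mem_closure (f := fun y : C(Icc (0 : ℝ) T, X) => y.comp delay)
    (ContinuousMap.continuous_precomp delay)
    (primitiveOn_mem_closure hT hAC x) ?_
  rintro _ ⟨u, rfl⟩
  refine ⟨(Ioi a).indicator fun _ => u, (memLp_const u).indicator measurableSet_Ioi, fun t => ?_⟩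
  have hcomp : (fun s => B ((Ioi a).indicator (fun _ => u) s)) =
      (Ioi a).indicator fun _ => B u := by
    ext s
    by_cases hs : s ∈ Ioi a <;> simp [hs]
  rw [hcomp]
  exact (ContinuousMap.congr_fun (hdelay (B u)) t).symm

theorem indicator_Ioc_mem_trackable (hT : 0 ≤ T)
    (hAC : ∀ G : X →L[𝕜] X, ApproximatelyControllable S B (fun _ y => G y) T) {a b : ℝ}
    (ha : 0 ≤ a) (hab : a ≤ b) (x : X) : ((Ioc a b).indicator fun _ => x) ∈ S.trackable B T := by
  have hdiff : ((Ioc a b).indicator fun _ => x) =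
      ((Ioi a).indicator fun _ => x) - (Ioi b).indicator fun _ => x := by
    rw [← indicator_sdiff (Ioi_subset_Ioi hab), Ioi_sdiff_Ioi]
  rw [hdiff]
  exact Submodule.sub_mem _ (indicator_Ioi_mem_trackable hT hAC ha x)
    (indicator_Ioi_mem_trackable hT hAC (ha.trans hab) x)

theorem IccExtend_mem_trackable (hT : 0 ≤ T)
    (hAC : ∀ G : X →L[𝕜] X, ApproximatelyControllable S B (fun _ y => G y) T)
    (k : C(Icc (0 : ℝ) T, X)) : IccExtend hT k ∈ S.trackable B T :=
  mem_trackable_of_forall_exists_norm_sub_le (integrableOn_IccExtend hT k) fun _ hε =>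
    exists_mem_forall_norm_sub_le_of_uniformContinuous
      (fun _ _ x ha hab => indicator_Ioc_mem_trackable hT hAC ha hab x)
      ((CompactSpace.uniformContinuous_of_continuous k.continuous).comp
        (LipschitzWith.projIcc hT).uniformContinuous) T hε

end Tracking

end C0Semigroup

/-! ### Semilinear trajectories -/

section RadialClip

variable {E : Type*} [NormedAddCommGroup E] [NormedSpace ℝ E] {R : ℝ}

/-- The radial retraction of a normed space onto its closed ball of radius `R > 0`. It makes a
nonlinearity bounded without changing it on the ball. -/
noncomputable def radialClip (hR : 0 < R) : C(E, E) :=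
  ⟨fun x => (R / max R ‖x‖) • x,
    (continuous_const.div (continuous_const.max continuous_norm)
      fun _ => (lt_max_of_lt_left hR).ne').smul continuous_id⟩

theorem norm_radialClip_le (hR : 0 < R) (x : E) : ‖radialClip hR x‖ ≤ R := by
  have hmax : 0 < max R ‖x‖ := lt_max_of_lt_left hR
  change ‖(R / max R ‖x‖) • x‖ ≤ R
  rw [norm_smul, Real.norm_of_nonneg (by positivity), div_mul_eq_mul_div, div_le_iff₀ hmax]
  exact mul_le_mul_of_nonneg_left (le_max_right _ _) hR.le

theorem radialClip_of_norm_le (hR : 0 < R) {x : E} (hx : ‖x‖ ≤ R) : radialClip hR x = x := by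
  change (R / max R ‖x‖) • x = x
  rw [max_eq_left hx, div_self hR.ne', one_smul]

end RadialClip

namespace C0Semigroup

variable {𝕜 X U : Type*} [RCLike 𝕜] [NormedAddCommGroup X] [InnerProductSpace 𝕜 X]
  [NormedSpace ℝ X] [CompleteSpace X] [NormedAddCommGroup U] [InnerProductSpace 𝕜 U]

section NonlinearResponse

variable (S : C0Semigroup 𝕜 X) {T : ℝ} (hT : 0 ≤ T) (F : C(Icc (0 : ℝ) T × X, X))

/-- The map `y ↦ (t ↦ ∫₀ᵗ S (t - s) F(s, y(s)) ds)` on `C([0, T], X)`, whose perturbation by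
`t ↦ S t y₀` and by a trajectory of the linear control system has mild solutions as fixed points. -/
noncomputable def nonlinearResponse (y : C(Icc (0 : ℝ) T, X)) : C(Icc (0 : ℝ) T, X) :=
  S.convOn (integrableOn_IccExtend hT (F.comp ((ContinuousMap.id _).prodMk y)))

theorem continuous_nonlinearResponse : Continuous (S.nonlinearResponse hT F) := by
  have hsup : Continuous fun y : C(Icc (0 : ℝ) T, X) => F.comp ((ContinuousMap.id _).prodMk y) :=
    ContinuousMap.continuous_of_continuous_uncurry _
      (F.continuous.comp (continuous_snd.prodMk continuous_eval))
  obtain ⟨C, -, hC⟩ := S.exists_forall_norm_convOn_sub_le T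
  refine continuous_iff_continuousAt.2 fun y => tendsto_iff_norm_sub_tendsto_zero.2 ?_
  refine squeeze_zero (fun _ => norm_nonneg _) (fun x => hC _ _ (norm_nonneg _) fun s _ =>
    ContinuousMap.norm_coe_le_norm
      (F.comp ((ContinuousMap.id _).prodMk x) - F.comp ((ContinuousMap.id _).prodMk y))
      (projIcc 0 T hT s)) ?_
  simpa using (tendsto_iff_norm_sub_tendsto_zero.1 (hsup.tendsto y)).const_mul C

variable {S F}

theorem isCompact_closure_range_nonlinearResponse (hS : S.IsCompact) {m : ℝ}
    (hF : ∀ p, ‖F p‖ ≤ m) : _root_.IsCompact (closure (range (S.nonlinearResponse hT F))) := by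
  have hm : 0 ≤ m := (norm_nonneg _).trans (hF (⟨0, le_rfl, hT⟩, 0))
  refine (isCompact_closure_convOn hS T hm).of_isClosed_subset isClosed_closure
    (closure_mono (range_subset_iff.2 fun y => ?_))
  exact ⟨_, integrableOn_IccExtend hT _, fun s _ => hF _, rfl⟩

theorem nonlinearResponse_mem_closure_reachable {B : U →L[𝕜] X}
    (hAC : ∀ G : X →L[𝕜] X, ApproximatelyControllable S B (fun _ y => G y) T)
    (y : C(Icc (0 : ℝ) T, X)) :
    S.nonlinearResponse hT F y ∈ closure (S.reachable B T : Set C(Icc (0 : ℝ) T, X)) :=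
  (IccExtend_mem_trackable hT hAC _).2

theorem exists_isMildSolution_IccExtend {B : U →L[𝕜] X} {N : ℝ → X → X} {y₀ : X}
    {y : C(Icc (0 : ℝ) T, X)} (hF : ∀ t, F (t, y t) = N t (y t))
    (hy : y - S.nonlinearResponse hT F y - S.orbitOn T y₀ ∈ S.reachable B T) :
    ∃ u : ℝ → U, MemLp u 2 (volume.restrict (Icc 0 T)) ∧
      IsMildSolution S B N T y₀ u (IccExtend hT y) := by
  obtain ⟨u, hu, hyu⟩ := hy
  refine ⟨u, hu, y.continuous.Icc_extend'.continuousOn, fun t ht => ?_⟩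
  let k : C(Icc (0 : ℝ) T, X) := F.comp ((ContinuousMap.id _).prodMk y)
  have hk : ∀ s ∈ Icc 0 T, IccExtend hT k s = N s (IccExtend hT y s) := fun s hs => by
    rw [IccExtend_of_mem hT _ hs, IccExtend_of_mem hT _ hs]
    exact hF ⟨s, hs⟩
  calc IccExtend hT y t = y ⟨t, ht⟩ := IccExtend_of_mem hT y ht
    _ = S t y₀ + (S.conv (fun s => B (u s)) t + S.conv (IccExtend hT k) t) := by
      have hyt : y ⟨t, ht⟩ - S.conv (IccExtend hT k) t - S t y₀ = S.conv (fun s => B (u s)) t :=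
        hyu ⟨t, ht⟩
      rw [← hyt]
      abel
    _ = S t y₀ + S.conv ((fun s => B (u s)) + IccExtend hT k) t := by
      rw [conv_add (integrableOn_control B hu) (integrableOn_IccExtend hT k) ht]
    _ = S t y₀ + ∫ s in (0 : ℝ)..t, S (t - s) (B (u s) + N s (IccExtend hT y s)) := by
      congr 1
      refine intervalIntegral.integral_congr fun s hs => ?_
      rw [uIcc_of_le ht.1] at hs
      simp only [Pi.add_apply, hk s ⟨hs.1, hs.2.trans ht.2⟩]

end NonlinearResponse

section FiniteApproximateControl

variable {S : C0Semigroup 𝕜 X} {B : U →L[𝕜] X} {T : ℝ}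

theorem dense_map_eval_reachable (hT : 0 ≤ T)
    (hAC : ApproximatelyControllable S B (fun _ _ => 0) T) :
    Dense ((S.reachable B T).map (ContinuousMap.evalCLM (M := X) 𝕜
      (⟨T, hT, le_rfl⟩ : Icc (0 : ℝ) T)).toLinearMap : Set X) := by
  refine Metric.dense_iff.2 fun x ε hε => ?_
  obtain ⟨u, y, hu, hy, -, hyx⟩ := hAC 0 x ε hε
  refine ⟨y T, by rwa [Metric.mem_ball, dist_eq_norm],
    S.convOn (integrableOn_control B hu), ⟨u, hu, fun _ => rfl⟩, ?_⟩
  simp [hy.2 T ⟨hT, le_rfl⟩, convOn, conv]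

theorem exists_sub_orbitOn_mem_reachable_map_eq_norm_sub_lt (hT : 0 ≤ T)
    (hAC : ApproximatelyControllable S B (fun _ _ => 0) T)
    {V : Type*} [NormedAddCommGroup V] [NormedSpace 𝕜 V] [FiniteDimensional 𝕜 V]
    {ℓ : X →L[𝕜] V} (hℓ : Function.Surjective ℓ) (y₀ yf : X) {ε : ℝ} (hε : 0 < ε) :
    ∃ z : C(Icc (0 : ℝ) T, X), z - S.orbitOn T y₀ ∈ S.reachable B T ∧
      ℓ (z ⟨T, hT, le_rfl⟩) = ℓ yf ∧ ‖z ⟨T, hT, le_rfl⟩ - yf‖ < ε := by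
  obtain ⟨_, ⟨r, hr, rfl⟩, hrℓ, hrε⟩ :=
    exists_mem_map_eq_norm_sub_lt (dense_map_eval_reachable hT hAC) hℓ (yf - S T y₀) hε
  refine ⟨S.orbitOn T y₀ + r, by simpa using hr, ?_, ?_⟩
  · rw [ContinuousMap.add_apply, _root_.map_add, orbitOn_apply, ← eq_sub_iff_add_eq', ← map_sub]
    exact hrℓ
  · rwa [ContinuousMap.add_apply, orbitOn_apply, add_comm, ← sub_sub_eq_add_sub]

theorem exists_isMildSolution_map_eq_norm_sub_lt (hT : 0 ≤ T) (hS : S.IsCompact)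
    {N : ℝ → X → X} (hN : ContinuousOn (fun p : ℝ × X => N p.1 p.2) (Icc 0 T ×ˢ univ))
    (hNb : ∀ R, ∃ m, ∀ t ∈ Icc (0 : ℝ) T, ∀ z, ‖z‖ ≤ R → ‖N t z‖ ≤ m)
    (hAC : ∀ G : X →L[𝕜] X, ApproximatelyControllable S B (fun _ y => G y) T)
    {V : Type*} [NormedAddCommGroup V] [NormedSpace 𝕜 V] [FiniteDimensional 𝕜 V]
    {ℓ : C(Icc (0 : ℝ) T, X) →L[𝕜] V} (hℓ : (S.reachable B T).map ℓ.toLinearMap = ⊤)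
    {y₀ : X} {z : C(Icc (0 : ℝ) T, X)} (hz : z - S.orbitOn T y₀ ∈ S.reachable B T)
    {ε : ℝ} (hε : 0 < ε) :
    ∃ (u : ℝ → U) (y : C(Icc (0 : ℝ) T, X)), MemLp u 2 (volume.restrict (Icc 0 T)) ∧
      IsMildSolution S B N T y₀ u (IccExtend hT y) ∧ ℓ y = ℓ z ∧ ‖y - z‖ < ε := by
  have hR : 0 < ‖z‖ + ε := by positivity
  obtain ⟨m, hm⟩ := hNb (‖z‖ + ε)
  let F : C(Icc (0 : ℝ) T × X, X) := ⟨fun p => N p.1 (radialClip hR p.2),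
    hN.comp_continuous (f := fun p : Icc (0 : ℝ) T × X => ((p.1 : ℝ), radialClip hR p.2))
      (by fun_prop) fun p => ⟨p.1.2, mem_univ _⟩⟩
  have : IsScalarTower ℝ 𝕜 X := Real.isScalarTower
  obtain ⟨y, hy, hyℓ, hyz⟩ := exists_sub_mem_map_eq_norm_sub_lt hℓ
    (S.continuous_nonlinearResponse hT F)
    (isCompact_closure_range_nonlinearResponse hT hS fun p =>
      hm p.1 p.1.2 _ (norm_radialClip_le hR p.2))
    (nonlinearResponse_mem_closure_reachable hT hAC) z hε
  have hyR : ‖y‖ ≤ ‖z‖ + ε := (norm_le_norm_add_norm_sub' y z).trans (by linarith)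
  have hclip : ∀ t, F (t, y t) = N t (y t) := fun t =>
    congrArg (N t) (radialClip_of_norm_le hR ((y.norm_coe_le_norm t).trans hyR))
  have hyy₀ : y - S.nonlinearResponse hT F y - S.orbitOn T y₀ ∈ S.reachable B T :=
    sub_add_sub_cancel _ z _ ▸ (S.reachable B T).add_mem hy hz
  obtain ⟨u, hu, hmild⟩ := exists_isMildSolution_IccExtend hT hclip hyy₀
  exact ⟨u, y, hu, hmild, hyℓ, hyz⟩

end FiniteApproximateControl

end C0Semigroup

theorem mainTheorem1_general {𝕜 X U : Type*} [RCLike 𝕜]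
    [NormedAddCommGroup X] [InnerProductSpace 𝕜 X] [NormedSpace ℝ X] [CompleteSpace X]
    [NormedAddCommGroup U] [InnerProductSpace 𝕜 U]
    {T : ℝ} (hT : 0 ≤ T) {S : C0Semigroup 𝕜 X} (hS : S.IsCompact) {B : U →L[𝕜] X}
    {N : ℝ → X → X} (hN : ContinuousOn (fun p : ℝ × X => N p.1 p.2) (Icc 0 T ×ˢ univ))
    (hNb : ∀ R, ∃ m, ∀ t ∈ Icc (0 : ℝ) T, ∀ z, ‖z‖ ≤ R → ‖N t z‖ ≤ m)
    (hAC : ∀ G : X →L[𝕜] X, ApproximatelyControllable S B (fun _ y => G y) T)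
    (M : Submodule 𝕜 X) [FiniteDimensional 𝕜 M] :
    FiniteApproximatelyControllable S B N T M := by
  intro y₀ yf ε hε
  let τ : Icc (0 : ℝ) T := ⟨T, hT, le_rfl⟩
  have hAC₀ : ApproximatelyControllable S B (fun _ _ => 0) T := by simpa using hAC 0
  have hsurj : Function.Surjective M.orthogonalProjectionOnto := fun c => ⟨c, by simp⟩
  have hmap := map_eq_top_of_dense (C0Semigroup.dense_map_eval_reachable hT hAC₀) hsurj
  obtain ⟨z, hz, hzM, hzf⟩ := C0Semigroup.exists_sub_orbitOn_mem_reachable_map_eq_norm_sub_lt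
    hT hAC₀ hsurj y₀ yf (half_pos hε)
  obtain ⟨u, y, hu, hy, hyM, hyz⟩ := C0Semigroup.exists_isMildSolution_map_eq_norm_sub_lt
    (ℓ := M.orthogonalProjectionOnto ∘L ContinuousMap.evalCLM 𝕜 τ) hT hS hN hNb hAC
    (by rw [← hmap, ← Submodule.map_comp]; rfl) hz (half_pos hε)
  have hyT : IccExtend hT y T = y τ := IccExtend_of_mem hT y τ.2
  refine ⟨u, IccExtend hT y, hu, hy, ?_, ?_, ?_⟩
  · rw [hy.2 0 ⟨le_rfl, hT⟩, intervalIntegral.integral_same, S.map_zero, add_zero]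
    rfl
  · rw [hyT]
    have hyzτ : ‖y τ - z τ‖ < ε / 2 := ((y - z).norm_coe_le_norm τ).trans_lt hyz
    linarith [norm_sub_le_norm_sub_add_norm_sub (y τ) (z τ) yf]
  · rw [hyT, Submodule.starProjection_apply, Submodule.starProjection_apply]
    exact congrArg _ (hyM.trans hzM)

theorem HasBoundedC1State.exists_norm_add_le {𝕜 X : Type*} [RCLike 𝕜] [NormedAddCommGroup X]
    [InnerProductSpace 𝕜 X] {f g : ℝ → X → X} {T : ℝ} (hf : HasBoundedC1State 𝕜 f T)
    (hg : IsContinuousDominated g T) (R : ℝ) :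
    ∃ m, ∀ t ∈ Icc (0 : ℝ) T, ∀ z, ‖z‖ ≤ R → ‖f t z + g t z‖ ≤ m := by
  obtain ⟨hfc, hfd, -, L, hL0, hL⟩ := hf
  obtain ⟨-, m, hmc, -, hgm⟩ := hg
  have hf0 : ContinuousOn (fun t => f t 0) (Icc 0 T) :=
    hfc.comp (f := fun t : ℝ => (t, (0 : X))) (by fun_prop) fun t ht => ⟨ht, mem_univ _⟩
  obtain ⟨a, ha⟩ := isCompact_Icc.exists_bound_of_continuousOn hf0
  obtain ⟨b, hb⟩ := isCompact_Icc.exists_bound_of_continuousOn hmc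
  refine ⟨a + L * R + b, fun t ht z hz => ?_⟩
  have hflip : LipschitzWith ⟨L, hL0.le⟩ (f t) :=
    lipschitzWith_of_nnnorm_fderiv_le (𝕜 := 𝕜) (hfd t ht) fun z => hL t ht z
  have hfz : ‖f t z‖ ≤ a + L * R := calc
    ‖f t z‖ ≤ ‖f t 0‖ + ‖f t z - f t 0‖ := norm_le_norm_add_norm_sub' _ _
    _ ≤ a + L * ‖z - 0‖ := add_le_add (ha t ht) (hflip.norm_sub_le z 0)
    _ ≤ a + L * R := by rw [sub_zero]; gcongr
  exact (norm_add_le _ _).trans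
    (add_le_add hfz ((hgm t ht z).trans ((Real.le_norm_self _).trans (hb t ht))))

theorem mainTheorem1 {𝕜 X U : Type*} [RCLike 𝕜]
    [NormedAddCommGroup X] [InnerProductSpace 𝕜 X] [NormedSpace ℝ X]
    [CompleteSpace X] [TopologicalSpace.SeparableSpace X]
    [NormedAddCommGroup U] [InnerProductSpace 𝕜 U]
    [CompleteSpace U] [TopologicalSpace.SeparableSpace U]
    (T : ℝ) (hT : 0 < T)
    (A : X →ₗ.[𝕜] X) (S : C0Semigroup 𝕜 X) (hA : S.IsGenerator A) (hS : S.IsCompact)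
    (B : U →L[𝕜] X)
    (f g : ℝ → X → X) (hf : HasBoundedC1State 𝕜 f T) (hg : IsContinuousDominated g T)
    (hAC : ∀ G : ℝ → X →L[𝕜] X, MemLp G 2 (volume.restrict (Icc 0 T)) →
      ApproximatelyControllable S B (fun t y => G t y) T)
    (M : Submodule 𝕜 X) [FiniteDimensional 𝕜 M] :
    FiniteApproximatelyControllable S B (fun t y => f t y + g t y) T M :=
  mainTheorem1_general hT.le hS (hf.1.add hg.1) (hf.exists_norm_add_le hg)
    (fun G => hAC (fun _ => G) (memLp_const G)) M
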